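/- Let $K=\mathbb{Q}(\sqrt2,\sqrt3)$ and let $\mathfrak{g}$ be the 4-dimensional Lie algebra over $K$ with basis $e_1,\dots,e_4$ whose bracket is determined, through the dual basis $(e^i)$ and the formula $de^i(x,y)=-e^i([x,y])$, by $de^1=de^2=0$ and $$de^3=\sqrt2\,e^1\wedge e^3+e^2\wedge e^3-\tfrac1{\sqrt3}\,e^2\wedge e^4,\qquad de^4=\sqrt2\,e^1\wedge e^4-e^2\wedge e^4+\tfrac1{\sqrt3}\,e^2\wedge e^3 .$$ Then $\mathfrak{g}$ is solvable, with $\dim_K\mathfrak{g}'=2$ and $\mathfrak{g}''=0$, where $\mathfrak{g}'=[\mathfrak{g},\mathfrak{g}]$ and $\mathfrak{g}''=[\mathfrak{g}',\mathfrak{g}']$. There is a (simply connected) real Lie group with Lie algebra $\mathbb{R}\otimes_K\mathfrak{g}$, and on every Lie group with this Lie algebra the left-invariant Riemannian metric for which $e_1,\dots,e_4$ are orthonormal is non-trivially Bach-flat: its Bach tensor $$B_{ij}=\sum_{p}\nabla_p\nabla_j\rho_{ip}-\tfrac12\sum_{p}\nabla_p\nabla_p\rho_{ij}+\tfrac13\tau\rho_{ij}-\sum_{p}\rho_{pi}\rho_{pj}+\tfrac1{12}\Big(3\sum_{r,s}\rho_{rs}^2-\tau^2\Big)\delta_{ij}$$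 (components in an orthonormal frame, $\rho$ the Ricci tensor, $\tau$ the scalar curvature) vanishes identically, but the metric is neither conformally Einstein nor half conformally flat (that is, with $W_+=0$ or $W_-=0$ for the two halves of the Weyl tensor), not even on some non-empty open subset. -/

import Mathlib

open scoped Manifold ContDiff TensorProduct

noncomputable section

namespace BachFlat

/-! ### The Lie algebra over `ℚ(√2, √3)` -/

/-- The number field `ℚ(√2, √3)`, as a subfield of `ℝ`. -/
abbrev QSqrt : IntermediateField ℚ ℝ := IntermediateField.adjoin ℚ {√2, √3}

/-- `√2` as an element of `ℚ(√2, √3)`. -/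
def sqrtTwo : QSqrt := ⟨√2, IntermediateField.subset_adjoin _ _ (by simp)⟩

/-- `√3` as an element of `ℚ(√2, √3)`. -/
def sqrtThree : QSqrt := ⟨√3, IntermediateField.subset_adjoin _ _ (by simp)⟩

/-- The underlying vector space of the Lie algebra: coordinate vectors `(x 0, x 1, x 2, x 3)` with
respect to a basis `e₁, e₂, e₃, e₄`, so that `x i` is the value of the dual basis form
`e^(i+1)` at `x`. -/
def Alg : Type := Fin 4 → QSqrt

instance : AddCommGroup Alg := inferInstanceAs (AddCommGroup (Fin 4 → QSqrt))

instance : Module QSqrt Alg := inferInstanceAs (Module QSqrt (Fin 4 → QSqrt))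

/-- The basis `e₁, e₂, e₃, e₄` (indexed by `0, 1, 2, 3`). -/
def stdBasis : Module.Basis (Fin 4) QSqrt Alg := Pi.basisFun QSqrt (Fin 4)

/-- The value of the wedge product `e^(i+1) ∧ e^(j+1)` of two dual basis forms at `(x, y)`. -/
def wedge (i j : Fin 4) (x y : Alg) : QSqrt := x i * y j - x j * y i

/-- The exterior derivatives of the dual basis forms: `de¹ = de² = 0`,
`de³ = √2 e¹∧e³ + e²∧e³ - (1/√3) e²∧e⁴` and `de⁴ = √2 e¹∧e⁴ - e²∧e⁴ + (1/√3) e²∧e³`. -/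
def dForm : Fin 4 → Alg → Alg → QSqrt :=
  ![fun _ _ => 0,
    fun _ _ => 0,
    fun x y => sqrtTwo * wedge 0 2 x y + wedge 1 2 x y - (1 / sqrtThree) * wedge 1 3 x y,
    fun x y => sqrtTwo * wedge 0 3 x y - wedge 1 3 x y + (1 / sqrtThree) * wedge 1 2 x y]

/-- The Lie bracket, encoded by the exterior derivatives: `de^i(x, y) = -e^i([x, y])`. -/
instance : Bracket Alg Alg where
  bracket x y := fun i => -dForm i x y

theorem add_apply (x y : Alg) (i : Fin 4) : (x + y) i = x i + y i := rfl

theorem zero_apply (i : Fin 4) : (0 : Alg) i = 0 := rfl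

theorem smul_apply (c : QSqrt) (x : Alg) (i : Fin 4) : (c • x) i = c * x i := rfl

theorem bracket_apply (x y : Alg) (i : Fin 4) : ⁅x, y⁆ i = -dForm i x y := rfl

theorem alg_ext {x y : Alg} (h : ∀ i, x i = y i) : x = y := funext h

instance : LieRing Alg where
  add_lie x y z := alg_ext fun i => by
    fin_cases i <;> simp [bracket_apply, dForm, wedge, add_apply] <;> ring
  lie_add x y z := alg_ext fun i => by
    fin_cases i <;> simp [bracket_apply, dForm, wedge, add_apply] <;> ring
  lie_self x := alg_ext fun i => by
    fin_cases i <;> simp [bracket_apply, dForm, wedge, zero_apply] <;> ring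
  leibniz_lie x y z := alg_ext fun i => by
    fin_cases i <;> simp [bracket_apply, dForm, wedge, add_apply] <;> ring

instance : LieAlgebra QSqrt Alg where
  lie_smul c x y := alg_ext fun i => by
    fin_cases i <;> simp [bracket_apply, dForm, wedge, smul_apply] <;> ring

/-! ### Riemannian geometry of a parallelised 4-manifold

`g` is a Riemannian metric on a 4-manifold `M`, and `E = (E 0, …, E 3)` is a global smooth frame of
the tangent bundle, not assumed orthonormal. The frame only serves to take traces with respect to
`g` and to evaluate tensors; the tensors defined below, being tensors, do not depend on it. -/

section Riemannian

variable {M : Type*} [TopologicalSpace M] [ChartedSpace (EuclideanSpace ℝ (Fin 4)) M]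

variable (M) in
/-- Vector fields on `M`. -/
abbrev VField := (x : M) → TangentSpace (𝓡 4) x

variable (M) in
/-- Fields of bilinear forms on the tangent spaces of `M`. -/
abbrev FormField :=
  (x : M) → TangentSpace (𝓡 4) x →L[ℝ] TangentSpace (𝓡 4) x →L[ℝ] ℝ

/-- The function `g(X, Y)`. -/
def pair (g : FormField M) (X Y : VField M) : M → ℝ := fun x => g x (X x) (Y x)

/-- The derivative `X f` of a function `f` along the vector field `X`. -/
def dir (X : VField M) (f : M → ℝ) : M → ℝ := fun x => mvfderiv (𝓡 4) f x (X x)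

/-- The Lie bracket `[X, Y]` of vector fields. -/
def brk (X Y : VField M) : VField M := VectorField.mlieBracket (𝓡 4) X Y

/-- The Gram matrix `g_{ij} = g(E_i, E_j)` at the point `x`. -/
def gram (g : FormField M) (E : Fin 4 → VField M) (x : M) : Matrix (Fin 4) (Fin 4) ℝ :=
  Matrix.of fun i j => pair g (E i) (E j) x

/-- The inverse matrix `g^{ij}` at the point `x`. -/
def gInv (g : FormField M) (E : Fin 4 → VField M) (i j : Fin 4) (x : M) : ℝ :=
  (gram g E x)⁻¹ i j

/-- Koszul's expression for `g(∇_X Y, Z)`. -/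
def koszul (g : FormField M) (X Y Z : VField M) : M → ℝ := fun x =>
  (1 / 2) * (dir X (pair g Y Z) x + dir Y (pair g X Z) x - dir Z (pair g X Y) x
    + pair g (brk X Y) Z x - pair g (brk X Z) Y x - pair g (brk Y Z) X x)

/-- The Levi-Civita derivative `∇_X Y`: the vector field whose inner products are given by
Koszul's formula. -/
def nabla (g : FormField M) (E : Fin 4 → VField M) (X Y : VField M) : VField M := fun x =>
  ∑ k, (∑ l, gInv g E k l x * koszul g X Y (E l) x) • E k x

/-- The curvature operator `R(X, Y) Z = ∇_X ∇_Y Z - ∇_Y ∇_X Z - ∇_[X,Y] Z`. -/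
def curv (g : FormField M) (E : Fin 4 → VField M) (X Y Z : VField M) : VField M := fun x =>
  nabla g E X (nabla g E Y Z) x - nabla g E Y (nabla g E X Z) x - nabla g E (brk X Y) Z x

/-- The Ricci tensor `ρ(Y, Z)`, the trace of `X ↦ R(X, Y) Z`. -/
def ricci (g : FormField M) (E : Fin 4 → VField M) (Y Z : VField M) : M → ℝ := fun x =>
  ∑ p, ∑ q, gInv g E p q x * pair g (curv g E (E p) Y Z) (E q) x

/-- The scalar curvature `τ`. -/
def scal (g : FormField M) (E : Fin 4 → VField M) : M → ℝ := fun x =>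
  ∑ p, ∑ q, gInv g E p q x * ricci g E (E p) (E q) x

/-- The squared norm `|ρ|²` of the Ricci tensor. -/
def ricciNormSq (g : FormField M) (E : Fin 4 → VField M) : M → ℝ := fun x =>
  ∑ p, ∑ q, ∑ r, ∑ s, gInv g E p r x * gInv g E q s x *
    (ricci g E (E p) (E q) x * ricci g E (E r) (E s) x)

/-- The covariant derivative `(∇_X ρ)(Y, Z)` of the Ricci tensor. -/
def nablaRicci (g : FormField M) (E : Fin 4 → VField M) (X Y Z : VField M) : M → ℝ := fun x =>
  dir X (ricci g E Y Z) x - ricci g E (nabla g E X Y) Z x - ricci g E Y (nabla g E X Z) x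

/-- The second covariant derivative `(∇²_{X,Y} ρ)(Z, T) = (∇_X (∇ρ))(Y; Z, T)`. -/
def nablaNablaRicci (g : FormField M) (E : Fin 4 → VField M) (X Y Z T : VField M) : M → ℝ :=
  fun x =>
    dir X (nablaRicci g E Y Z T) x - nablaRicci g E (nabla g E X Y) Z T x
      - nablaRicci g E Y (nabla g E X Z) T x - nablaRicci g E Y Z (nabla g E X T) x

/-- The Bach tensor, which with respect to an orthonormal basis reads
`B_ij = ∑_p ∇_p ∇_j ρ_ip - ½ ∑_p ∇_p ∇_p ρ_ij + ⅓ τ ρ_ij - ∑_p ρ_pi ρ_pj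
  + (1/12) (3 |ρ|² - τ²) δ_ij`. -/
def bach (g : FormField M) (E : Fin 4 → VField M) (X Y : VField M) : M → ℝ := fun x =>
  (∑ p, ∑ q, gInv g E p q x * nablaNablaRicci g E (E p) Y X (E q) x)
    - (1 / 2) * (∑ p, ∑ q, gInv g E p q x * nablaNablaRicci g E (E p) (E q) X Y x)
    + (1 / 3) * (scal g E x * ricci g E X Y x)
    - (∑ p, ∑ q, gInv g E p q x * (ricci g E (E p) X x * ricci g E (E q) Y x))
    + (1 / 12) * ((3 * ricciNormSq g E x - scal g E x ^ 2) * pair g X Y x)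

/-- The metric has zero Bach tensor. -/
def IsBachFlat (g : FormField M) (E : Fin 4 → VField M) : Prop :=
  ∀ x : M, ∀ i j, bach g E (E i) (E j) x = 0

/-- The metric is Einstein on the open set `U`: `ρ = c g` there, for some constant `c`. -/
def IsEinsteinOn (g : FormField M) (E : Fin 4 → VField M) (U : Set M) : Prop :=
  ∃ c : ℝ, ∀ x ∈ U, ∀ i j, ricci g E (E i) (E j) x = c * pair g (E i) (E j) x

/-- The conformally equivalent metric `e^{2f} g`. -/
def conformal (f : M → ℝ) (g : FormField M) : FormField M := fun x => Real.exp (2 * f x) • g x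

/-- The conformal class of the metric contains an Einstein metric on the open set `U`. -/
def IsConformallyEinsteinOn (g : FormField M) (E : Fin 4 → VField M) (U : Set M) : Prop :=
  ∃ f : M → ℝ, ContMDiffOn (𝓡 4) 𝓘(ℝ) ∞ f U ∧ IsEinsteinOn (conformal f g) E U

/-- The Schouten tensor `½ (ρ - (τ/6) g)` in dimension four. -/
def schouten (g : FormField M) (E : Fin 4 → VField M) (X Y : VField M) : M → ℝ := fun x =>
  (1 / 2) * (ricci g E X Y x - scal g E x / 6 * pair g X Y x)

/-- The Weyl tensor `W(X, Y, Z, T)`: the totally trace-free part of `g(R(X, Y) Z, T)`. -/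
def weyl (g : FormField M) (E : Fin 4 → VField M) (X Y Z T : VField M) : M → ℝ := fun x =>
  pair g (curv g E X Y Z) T x
    - (pair g Y Z x * schouten g E X T x + schouten g E Y Z x * pair g X T x
      - pair g X Z x * schouten g E Y T x - schouten g E X Z x * pair g Y T x)

/-- The Levi-Civita symbol: the sign of `(a, b, c, d)` as a permutation of `(0, 1, 2, 3)`, and `0`
if two of the indices coincide. -/
def levi (a b c d : Fin 4) : ℝ :=
  Matrix.det (Matrix.of fun i j : Fin 4 => if ![a, b, c, d] i = j then (1 : ℝ) else 0)

/-- The tensor `∗W`, evaluated at `(E a, E b, E c, E d)`, where the Hodge star of the orientation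
given by the frame acts on the first two arguments: `½ ∑ vol_{abmn} W^{mn}_{cd}` with the volume
form `vol_{abmn} = √(det g) levi a b m n`. -/
def starWeyl (g : FormField M) (E : Fin 4 → VField M) (a b c d : Fin 4) : M → ℝ := fun x =>
  (1 / 2) * ∑ m, ∑ n, ∑ p, ∑ q, √((gram g E x).det) * levi a b m n *
    (gInv g E m p x * gInv g E n q x * weyl g E (E p) (E q) (E c) (E d) x)

/-- The self-dual part `W₊ = ½ (W + ∗W)` of the Weyl tensor, in the frame. -/
def weylPlus (g : FormField M) (E : Fin 4 → VField M) (a b c d : Fin 4) : M → ℝ := fun x =>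
  (1 / 2) * (weyl g E (E a) (E b) (E c) (E d) x + starWeyl g E a b c d x)

/-- The anti-self-dual part `W₋ = ½ (W - ∗W)` of the Weyl tensor, in the frame. -/
def weylMinus (g : FormField M) (E : Fin 4 → VField M) (a b c d : Fin 4) : M → ℝ := fun x =>
  (1 / 2) * (weyl g E (E a) (E b) (E c) (E d) x - starWeyl g E a b c d x)

/-- The metric is half conformally flat on `U`: there `W₊ = 0` or `W₋ = 0`. -/
def IsHalfConformallyFlatOn (g : FormField M) (E : Fin 4 → VField M) (U : Set M) : Prop :=
  (∀ x ∈ U, ∀ a b c d, weylPlus g E a b c d x = 0) ∨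
    (∀ x ∈ U, ∀ a b c d, weylMinus g E a b c d x = 0)

/-- The metric is non-trivially Bach-flat: it is Bach-flat, but neither conformally Einstein nor
half conformally flat, not even on some non-empty open subset (possibly the whole manifold). -/
def IsNontriviallyBachFlat (g : FormField M) (E : Fin 4 → VField M) : Prop :=
  IsBachFlat g E ∧
    ∀ U : Set M, IsOpen U → U.Nonempty →
      ¬ IsConformallyEinsteinOn g E U ∧ ¬ IsHalfConformallyFlatOn g E U

end Riemannian

/-! ### Lie groups -/

section LieGroups

instance : ENat.LEInfty (minSmoothness ℝ 3) :=
  ⟨by rw [minSmoothness_of_isRCLikeNormedField]; exact ENat.LEInfty.out⟩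

variable {G : Type*} [TopologicalSpace G] [ChartedSpace (EuclideanSpace ℝ (Fin 4)) G] [Group G]

/-- A field of bilinear forms on a Lie group is left-invariant. -/
def IsLeftInvariant (g : FormField G) : Prop :=
  ∀ (a x : G) (u v : TangentSpace (𝓡 4) x),
    g (a * x) (mfderiv (𝓡 4) (𝓡 4) (fun y : G => a * y) x u)
      (mfderiv (𝓡 4) (𝓡 4) (fun y : G => a * y) x v) = g x u v

/-- The frame of left-invariant vector fields given by a basis of the Lie algebra of `G`, which is
the tangent space at the identity. -/
def leftFrame (b : Module.Basis (Fin 4) ℝ (GroupLieAlgebra (𝓡 4) G)) : Fin 4 → VField G :=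
  fun i => mulInvariantVectorField (b i)

/-- The basis of the Lie algebra of `G` that corresponds to `e₁, e₂, e₃, e₄` under an identification
of it with the real Lie algebra obtained from `Alg` by extension of scalars. -/
def groupBasis [LieGroup (𝓡 4) ∞ G]
    (φ : (ℝ ⊗[QSqrt] Alg) ≃ₗ⁅ℝ⁆ GroupLieAlgebra (𝓡 4) G) :
    Module.Basis (Fin 4) ℝ (GroupLieAlgebra (𝓡 4) G) :=
  (Algebra.TensorProduct.basis ℝ stdBasis).map φ.toLinearEquiv

end LieGroups

end BachFlat

end

/-! A left-invariant frame coming from an orthonormal basis of the Lie algebra is orthonormal and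
has constant bracket coefficients `C` (`IsConstantFrame`). Koszul's formula then turns every tensor
of the metric into a polynomial in `C`, so geometry becomes algebra on `ℝ⁴`. Here `C` is
`structConst s t`, with `s = √2` and `t = 1/√3`. The Bach tensor is evaluated directly, and all its
components vanish because `s² = 2` and `t² = 1/3` (`bach_structConst`).

Half conformal flatness fails because of one component. In the 0-based indexing of the frame,
`W(E₀,E₁,E₀,E₁) = -2/3`, while `∗W` has value `0` there because `W(E₂,E₃,E₀,E₁) = 0`. Hence `W₊` and
`W₋` both have the value `-1/3` there, at every point.

Suppose `e^{2f} g` is Einstein on an open set, and put `uᵢ = Eᵢ f`. The Einstein constant enters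
only the diagonal Ricci components. The off-diagonal ones prescribe second derivatives
(`ric_conformal_off_diagonal`): `E₂E₁f = u₂ + u₁u₂`, `E₃E₁f = u₁u₃ - u₃`, `E₂E₃f = E₃E₂f = u₂u₃ +
t`. Since `[E₃,E₂] = 0`, the expression `E₃(E₂E₁f) - E₂(E₃E₁f)` must vanish. Substituting the second
derivatives reduces it to `2t`, which is not zero. This needs the Ricci tensor of `e^{2f} g` for a
function smooth only on `U` (`ricci_conformal_eq`), and the identity between brackets and
commutators of derivations (`dir_brk`). The formulas for `g` itself are the case `f = 0`.

For existence, `e₁` and `e₂` act on the derived algebra by commuting matrices that are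
diagonalizable over `ℝ`. Exponentiating this action gives a group `ℝ² ⋉ ℝ²` whose manifold is `ℝ⁴`,
hence simply connected. -/

noncomputable section

/-! ### Frames with constant structure functions -/

namespace BachFlat

open Filter Topology

section Frame

variable {M : Type*} [TopologicalSpace M] [ChartedSpace (EuclideanSpace ℝ (Fin 4)) M]

/-- The vector field with coefficient functions `h` in the frame `E`. -/
def comb (E : Fin 4 → VField M) (h : Fin 4 → M → ℝ) : VField M := fun x => ∑ k, h k x • E k x

/-- The vector field with constant coefficients `c` in the frame `E`. -/
def lin (E : Fin 4 → VField M) (c : Fin 4 → ℝ) : VField M := comb E fun k _ => c k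

theorem lin_single (E : Fin 4 → VField M) (i : Fin 4) : lin E (Pi.single i 1) = E i := by
  funext x
  simp [lin, comb, Pi.single_apply]

/-! #### Directional derivatives -/

theorem dir_const (X : VField M) (c : ℝ) : dir X (fun _ => c) = fun _ => 0 := by
  funext x
  simp [dir, mvfderiv_const]

theorem dir_add {X : VField M} {f h : M → ℝ} {x : M}
    (hf : MDifferentiableAt (𝓡 4) 𝓘(ℝ) f x) (hh : MDifferentiableAt (𝓡 4) 𝓘(ℝ) h x) :
    dir X (fun y => f y + h y) x = dir X f x + dir X h x := by
  simp only [dir]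
  rw [mvfderiv_fun_add hf hh]; rfl

theorem dir_mul {X : VField M} {f h : M → ℝ} {x : M}
    (hf : MDifferentiableAt (𝓡 4) 𝓘(ℝ) f x) (hh : MDifferentiableAt (𝓡 4) 𝓘(ℝ) h x) :
    dir X (fun y => f y * h y) x = f x * dir X h x + h x * dir X f x := by
  simp only [dir]
  rw [mvfderiv_fun_mul hf hh]; rfl

theorem dir_congr {X : VField M} {f h : M → ℝ} {x : M} (hfh : f =ᶠ[𝓝 x] h) :
    dir X f x = dir X h x := by
  simp only [dir, mvfderiv, hfh.mfderiv_eq]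
  rw [hfh.eq_of_nhds]

theorem dir_exp {X : VField M} {f : M → ℝ} {x : M} (hf : MDifferentiableAt (𝓡 4) 𝓘(ℝ) f x) :
    dir X (fun y => Real.exp (2 * f y)) x = Real.exp (2 * f x) * (2 * dir X f x) := by
  have h : HasMFDerivAt 𝓘(ℝ) 𝓘(ℝ) (fun t : ℝ => Real.exp (2 * t)) (f x) _ :=
    (((hasDerivAt_id (f x)).const_mul 2).exp).hasFDerivAt.hasMFDerivAt
  have := (h.comp x hf.hasMFDerivAt).mfderiv
  simp only [dir, mvfderiv]
  erw [this]
  change (dir X f x) • (Real.exp (2 * f x) * (2 * 1)) = Real.exp (2 * f x) * (2 * dir X f x)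
  rw [smul_eq_mul]
  ring

theorem dir_comb (E : Fin 4 → VField M) (h : Fin 4 → M → ℝ) (f : M → ℝ) (x : M) :
    dir (comb E h) f x = ∑ k, h k x * dir (E k) f x := by
  simp [dir, comb, map_sum]

theorem mdifferentiableAt_finset_sum {ι : Type*} (s : Finset ι) {f : ι → M → ℝ} {x : M}
    (hf : ∀ i ∈ s, MDifferentiableAt (𝓡 4) 𝓘(ℝ) (f i) x) :
    MDifferentiableAt (𝓡 4) 𝓘(ℝ) (fun y => ∑ i ∈ s, f i y) x := by
  induction s using Finset.cons_induction with
  | empty => simpa using mdifferentiableAt_const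
  | cons a s ha ih =>
    simp only [Finset.sum_cons]
    exact (hf a (by simp)).add (ih fun i hi => hf i (by simp [hi]))

theorem dir_sum {ι : Type*} (s : Finset ι) {X : VField M} {f : ι → M → ℝ} {x : M}
    (hf : ∀ i ∈ s, MDifferentiableAt (𝓡 4) 𝓘(ℝ) (f i) x) :
    dir X (fun y => ∑ i ∈ s, f i y) x = ∑ i ∈ s, dir X (f i) x := by
  induction s using Finset.cons_induction with
  | empty => simp [dir_const]
  | cons a s ha ih =>
    simp only [Finset.sum_cons]
    rw [dir_add (hf a (by simp))
      (mdifferentiableAt_finset_sum s fun i hi => hf i (by simp [hi])),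
      ih fun i hi => hf i (by simp [hi])]

theorem pair_conformal (g : FormField M) (f : M → ℝ) (X Y : VField M) :
    pair (conformal f g) X Y = fun x => Real.exp (2 * f x) * pair g X Y x := rfl

theorem conformal_apply (g : FormField M) (f : M → ℝ) (x : M) (u v : TangentSpace (𝓡 4) x) :
    conformal f g x u v = Real.exp (2 * f x) * g x u v := rfl

/-! #### Brackets -/

theorem brk_swap (X Y : VField M) (x : M) : brk X Y x = - brk Y X x :=
  VectorField.mlieBracket_swap_apply

variable [IsManifold (𝓡 4) ∞ M]

theorem mdifferentiableAt_sum_smul {ι : Type*} (s : Finset ι) {F : ι → VField M} {h : ι → M → ℝ}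
    {x : M} (hF : ∀ i, MDifferentiableAt (𝓡 4) (𝓡 4).tangent (T% (F i)) x)
    (hh : ∀ i, MDifferentiableAt (𝓡 4) 𝓘(ℝ) (h i) x) :
    MDifferentiableAt (𝓡 4) (𝓡 4).tangent (T% (fun y => ∑ i ∈ s, h i y • F i y)) x :=
  MDifferentiableAt.sum_section fun i _ => (hh i).smul_section (hF i)

theorem brk_sum_right {ι : Type*} (s : Finset ι) {X : VField M} {F : ι → VField M}
    {h : ι → M → ℝ} {x : M} (hF : ∀ i, MDifferentiableAt (𝓡 4) (𝓡 4).tangent (T% (F i)) x)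
    (hh : ∀ i, MDifferentiableAt (𝓡 4) 𝓘(ℝ) (h i) x) :
    brk X (fun y => ∑ i ∈ s, h i y • F i y) x =
      ∑ i ∈ s, (dir X (h i) x • F i x + h i x • brk X (F i) x) := by
  induction s using Finset.cons_induction with
  | empty =>
    simp only [Finset.sum_empty]
    exact congrFun VectorField.mlieBracket_zero_right x
  | cons a s ha ih =>
    simp only [Finset.sum_cons]
    rw [← ih]
    have h1 := VectorField.mlieBracket_add_right (V := X) (W := h a • F a)
      (W₁ := fun y => ∑ i ∈ s, h i y • F i y)
      ((hh a).smul_section (hF a)) (mdifferentiableAt_sum_smul s hF hh)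
    have h2 := VectorField.mlieBracket_smul_right (V := X) (hh a) (hF a)
    rw [h2] at h1
    exact h1

/-- The frame `E` is orthonormal for `g`, and its brackets have the constant coefficients `C`. -/
structure IsConstantFrame (g : FormField M) (E : Fin 4 → VField M)
    (C : Fin 4 → Fin 4 → Fin 4 → ℝ) : Prop where
  smooth : ∀ i, ContMDiff (𝓡 4) (𝓡 4).tangent 2 (T% (E i))
  brk_eq : ∀ i j, brk (E i) (E j) = lin E (C i j)
  orthonormal : ∀ x i j, g x (E i x) (E j x) = if i = j then 1 else 0

/-- The bilinear bracket on `ℝ⁴` with structure constants `C`. -/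
def lieC (C : Fin 4 → Fin 4 → Fin 4 → ℝ) (a b : Fin 4 → ℝ) : Fin 4 → ℝ := fun k =>
  ∑ i, ∑ j, a i * b j * C i j k

namespace IsConstantFrame

variable {g : FormField M} {E : Fin 4 → VField M} {C : Fin 4 → Fin 4 → Fin 4 → ℝ}

theorem mdifferentiableAt (hE : IsConstantFrame g E C) (i : Fin 4) (x : M) :
    MDifferentiableAt (𝓡 4) (𝓡 4).tangent (T% (E i)) x :=
  (hE.smooth i).mdifferentiable (by norm_num) x

theorem pair_comb (hE : IsConstantFrame g E C) (a b : Fin 4 → M → ℝ) :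
    pair g (comb E a) (comb E b) = fun x => ∑ k, a k x * b k x := by
  funext x
  simp [pair, comb, map_sum, hE.orthonormal, mul_comm]

theorem brk_frame_comb (hE : IsConstantFrame g E C) (i : Fin 4) {b : Fin 4 → M → ℝ} {x : M}
    (hb : ∀ k, MDifferentiableAt (𝓡 4) 𝓘(ℝ) (b k) x) :
    brk (E i) (comb E b) x =
      ∑ k, (dir (E i) (b k) x + ∑ j, b j x * C i j k) • E k x := by
  unfold comb
  rw [brk_sum_right _ (fun k => hE.mdifferentiableAt k x) hb]
  simp only [hE.brk_eq, lin, comb, Finset.smul_sum, add_smul, Finset.sum_add_distrib,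
    Finset.sum_smul, smul_smul]
  rw [Finset.sum_comm]

/-- The Leibniz rule is applied in each slot, with antisymmetry reducing the left slot to the right
one. The terms without derivatives assemble into `lieC`. -/
theorem brk_comb (hE : IsConstantFrame g E C) {a b : Fin 4 → M → ℝ} {x : M}
    (ha : ∀ k, MDifferentiableAt (𝓡 4) 𝓘(ℝ) (a k) x)
    (hb : ∀ k, MDifferentiableAt (𝓡 4) 𝓘(ℝ) (b k) x) :
    brk (comb E a) (comb E b) x =
      comb E (fun k y => dir (comb E a) (b k) y - dir (comb E b) (a k) y
        + lieC C (fun i => a i y) (fun i => b i y) k) x := by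
  have h1 : brk (comb E b) (comb E a) x = _ :=
    brk_sum_right (X := comb E b) Finset.univ (fun k => hE.mdifferentiableAt k x) ha
  rw [brk_swap, h1]
  simp_rw [brk_swap (comb E b), hE.brk_frame_comb _ hb, dir_comb E a]
  simp only [comb, lieC, add_smul, sub_smul, Finset.sum_add_distrib, Finset.sum_sub_distrib,
    Finset.sum_smul, smul_add, smul_neg, Finset.smul_sum, smul_smul, Finset.sum_neg_distrib]
  rw [Finset.sum_comm (f := fun i k => (a i x * dir (E i) (b k) x) • E k x)]
  rw [Finset.sum_comm (f := fun i k => ∑ j, (a i x * (b j x * C i j k)) • E k x)]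
  simp only [mul_assoc]
  abel

end IsConstantFrame

end Frame
end BachFlat

/-! ### The Levi-Civita connection of a conformally changed metric -/

namespace BachFlat

open Filter Topology

variable {M : Type*} [TopologicalSpace M] [ChartedSpace (EuclideanSpace ℝ (Fin 4)) M]

/-- The Levi-Civita connection of the left-invariant metric for which the standard basis is
orthonormal, on the Lie algebra `ℝ⁴` with structure constants `C`. -/
def conn (C : Fin 4 → Fin 4 → Fin 4 → ℝ) (a b : Fin 4 → ℝ) : Fin 4 → ℝ := fun l =>
  (1 / 2) * (lieC C a b l - ∑ k, lieC C a (Pi.single l 1) k * b k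
    - ∑ k, lieC C b (Pi.single l 1) k * a k)

/-- The coefficients of `∇_X Y` for the metric `e^{2f} g`, where `X = ∑ aₖ Eₖ` has constant
coefficients and `Y = ∑ hₖ Eₖ`. -/
def connConf (E : Fin 4 → VField M) (C : Fin 4 → Fin 4 → Fin 4 → ℝ) (f : M → ℝ)
    (a : Fin 4 → ℝ) (h : Fin 4 → M → ℝ) (l : Fin 4) (x : M) : ℝ :=
  dir (lin E a) (h l) x + dir (lin E a) f x * h l x + dir (comb E h) f x * a l
    - (∑ k, a k * h k x) * dir (E l) f x + conn C a (fun k => h k x) l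

/-- Koszul's expression contains only first derivatives of `Y`, so it sees only the germ. Iterated
covariant derivatives need this: on a conformally changed metric, the inner one is known only on an
open set. -/
theorem koszul_congr (g : FormField M) {X Y Y' Z : VField M} {x : M} (h : Y =ᶠ[𝓝 x] Y') :
    koszul g X Y Z x = koszul g X Y' Z x := by
  have e1 : pair g Y Z =ᶠ[𝓝 x] pair g Y' Z := by
    filter_upwards [h] with y hy; simp only [pair, hy]
  have e2 : pair g X Y =ᶠ[𝓝 x] pair g X Y' := by
    filter_upwards [h] with y hy; simp only [pair, hy]
  have e3 : brk X Y x = brk X Y' x :=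
    (EventuallyEq.refl _ X).mlieBracket_vectorField_eq h
  have e4 : brk Y Z x = brk Y' Z x :=
    h.mlieBracket_vectorField_eq (EventuallyEq.refl _ Z)
  simp only [koszul, dir_congr e1, dir_congr e2]
  simp only [pair, e3, e4, dir, h.eq_of_nhds]

theorem nabla_congr (g : FormField M) (E : Fin 4 → VField M) {X Y Y' : VField M} {x : M}
    (h : Y =ᶠ[𝓝 x] Y') : nabla g E X Y x = nabla g E X Y' x := by
  simp only [nabla, koszul_congr g h]

variable [IsManifold (𝓡 4) ∞ M]

namespace IsConstantFrame

variable {g : FormField M} {E : Fin 4 → VField M} {C : Fin 4 → Fin 4 → Fin 4 → ℝ}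

theorem pair_conformal_comb (hE : IsConstantFrame g E C) (f : M → ℝ) (a b : Fin 4 → M → ℝ) :
    pair (conformal f g) (comb E a) (comb E b) =
      fun x => Real.exp (2 * f x) * ∑ k, a k x * b k x := by
  rw [pair_conformal, hE.pair_comb]

theorem dir_pair_conformal (hE : IsConstantFrame g E C) (X : VField M) {f : M → ℝ}
    {a b : Fin 4 → M → ℝ} {x : M} (hf : MDifferentiableAt (𝓡 4) 𝓘(ℝ) f x)
    (ha : ∀ k, MDifferentiableAt (𝓡 4) 𝓘(ℝ) (a k) x)
    (hb : ∀ k, MDifferentiableAt (𝓡 4) 𝓘(ℝ) (b k) x) :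
    dir X (pair (conformal f g) (comb E a) (comb E b)) x =
      Real.exp (2 * f x) * (2 * dir X f x * (∑ k, a k x * b k x)
        + ∑ k, (a k x * dir X (b k) x + b k x * dir X (a k) x)) := by
  have he : MDifferentiableAt (𝓡 4) 𝓘(ℝ) (fun y => Real.exp (2 * f y)) x :=
    (show Differentiable ℝ fun t : ℝ => Real.exp (2 * t) by fun_prop).mdifferentiable
      |>.mdifferentiableAt.comp x hf
  have hm : ∀ k ∈ Finset.univ, MDifferentiableAt (𝓡 4) 𝓘(ℝ) (fun y => a k y * b k y) x :=
    fun k _ => (ha k).mul (hb k)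
  rw [hE.pair_conformal_comb, dir_mul he (mdifferentiableAt_finset_sum _ hm), dir_sum _ hm,
    dir_exp hf]
  simp_rw [fun k => dir_mul (X := X) (ha k) (hb k)]
  ring

theorem koszul_conformal (hE : IsConstantFrame g E C) {f : M → ℝ} (a : Fin 4 → ℝ)
    {h : Fin 4 → M → ℝ} (l : Fin 4) {x : M} (hf : MDifferentiableAt (𝓡 4) 𝓘(ℝ) f x)
    (hh : ∀ k, MDifferentiableAt (𝓡 4) 𝓘(ℝ) (h k) x) :
    koszul (conformal f g) (lin E a) (comb E h) (E l) x =
      Real.exp (2 * f x) * connConf E C f a h l x := by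
  have hc : ∀ (c : Fin 4 → ℝ) k, MDifferentiableAt (𝓡 4) 𝓘(ℝ) (fun _ : M => c k) x :=
    fun c k => mdifferentiableAt_const
  -- With `E l` written as a constant combination, all three arguments have the form `comb`, and the
  -- same pairing and bracket formulas cover every term.
  have key : koszul (conformal f g) (lin E a) (comb E h) (lin E (Pi.single l 1)) x =
      Real.exp (2 * f x) * connConf E C f a h l x := by
    unfold koszul lin
    rw [hE.dir_pair_conformal _ hf hh (hc _), hE.dir_pair_conformal _ hf (hc _) (hc _),
      hE.dir_pair_conformal _ hf (hc _) hh]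
    have hpair : ∀ (X Y : VField M) (p : Fin 4 → M → ℝ) (q : Fin 4 → M → ℝ),
        X x = comb E p x → Y = comb E q → pair (conformal f g) X Y x =
          Real.exp (2 * f x) * ∑ k, p k x * q k x := by
      intro X Y p q hX hY
      rw [← congrFun (hE.pair_conformal_comb f p q) x, hY]
      simp only [pair, hX]
    rw [hpair _ _ _ _ (hE.brk_comb (hc a) hh) rfl, hpair _ _ _ _ (hE.brk_comb (hc a) (hc _)) rfl,
      hpair _ _ _ _ (hE.brk_comb hh (hc _)) rfl]
    simp only [dir_const]
    have hs : ∀ (p : Fin 4 → ℝ), ∑ k, p k * (Pi.single l 1 : Fin 4 → ℝ) k = p l := by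
      intro p; simp [Pi.single_apply]
    have hs' : ∀ (p : Fin 4 → ℝ), ∑ k, (Pi.single l 1 : Fin 4 → ℝ) k * p k = p l := by
      intro p; simp [Pi.single_apply]
    simp only [mul_zero, zero_add, add_zero, zero_sub, sub_zero, hs, hs', add_mul, neg_mul,
      Finset.sum_add_distrib, Finset.sum_neg_distrib, connConf, conn]
    have h2 : comb E (fun k _ => (Pi.single l 1 : Fin 4 → ℝ) k) = E l := lin_single E l
    rw [h2]
    simp only [lin]
    simp only [mul_comm (dir (E l) _ x) (a _)]
    ring
  rwa [lin_single] at key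

theorem gram_conformal (hE : IsConstantFrame g E C) (f : M → ℝ) (x : M) :
    gram (conformal f g) E x = Real.exp (2 * f x) • (1 : Matrix (Fin 4) (Fin 4) ℝ) := by
  ext i j
  simp [gram, pair, conformal_apply, hE.orthonormal, Matrix.one_apply]

theorem gInv_conformal (hE : IsConstantFrame g E C) (f : M → ℝ) (i j : Fin 4) (x : M) :
    gInv (conformal f g) E i j x = if i = j then (Real.exp (2 * f x))⁻¹ else 0 := by
  have h : (gram (conformal f g) E x)⁻¹ =
      (Real.exp (2 * f x))⁻¹ • (1 : Matrix (Fin 4) (Fin 4) ℝ) := by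
    apply Matrix.inv_eq_right_inv
    rw [hE.gram_conformal]
    simp [smul_smul]
  simp [gInv, h, Matrix.one_apply]

theorem nabla_conformal (hE : IsConstantFrame g E C) {f : M → ℝ} (a : Fin 4 → ℝ)
    {h : Fin 4 → M → ℝ} {x : M} (hf : MDifferentiableAt (𝓡 4) 𝓘(ℝ) f x)
    (hh : ∀ k, MDifferentiableAt (𝓡 4) 𝓘(ℝ) (h k) x) :
    nabla (conformal f g) E (lin E a) (comb E h) x = comb E (connConf E C f a h) x := by
  unfold nabla
  rw [show comb E (connConf E C f a h) x = ∑ k, connConf E C f a h k x • E k x from rfl]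
  refine Finset.sum_congr rfl fun k _ => ?_
  congr 1
  have := (Real.exp_pos (2 * f x)).ne'
  have hk := fun l => hE.koszul_conformal a l hf hh
  simp only [hE.gInv_conformal, hk]
  simp [this]

theorem trace_conformal (hE : IsConstantFrame g E C) (f : M → ℝ) (T : Fin 4 → Fin 4 → ℝ) (x : M) :
    ∑ p, ∑ q, gInv (conformal f g) E p q x * T p q = (Real.exp (2 * f x))⁻¹ * ∑ p, T p p := by
  simp [hE.gInv_conformal, Finset.mul_sum]

theorem pair_conformal_frame (hE : IsConstantFrame g E C) (f : M → ℝ) {X : VField M}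
    {p : Fin 4 → ℝ} {x : M} (hX : X x = ∑ k, p k • E k x) (q : Fin 4) :
    pair (conformal f g) X (E q) x = Real.exp (2 * f x) * p q := by
  simp [pair, conformal_apply, hX, hE.orthonormal, mul_comm]

/-- The factor `e^{-2f}` of the inverse metric cancels the `e^{2f}` of the pairing, leaving a plain
trace of frame coefficients. -/
theorem ricci_conformal (hE : IsConstantFrame g E C) {f : M → ℝ} {Y Z : VField M}
    {r : Fin 4 → Fin 4 → ℝ} {x : M}
    (h : ∀ p, curv (conformal f g) E (E p) Y Z x = ∑ k, r p k • E k x) :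
    ricci (conformal f g) E Y Z x = ∑ p, r p p := by
  have := (Real.exp_pos (2 * f x)).ne'
  unfold ricci
  rw [hE.trace_conformal]
  simp_rw [fun p => hE.pair_conformal_frame f (h p) p]
  rw [← Finset.mul_sum, inv_mul_cancel_left₀ this]

end IsConstantFrame
end BachFlat

/-! ### Commutators of derivations -/

namespace BachFlat

open Filter Topology

variable {M : Type*} [TopologicalSpace M] [ChartedSpace (EuclideanSpace ℝ (Fin 4)) M]
  [IsManifold (𝓡 4) ∞ M]

/-- The derivative of a `Cⁿ⁺¹` function along a `Cⁿ` vector field is `Cⁿ`. -/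
theorem contMDiffOn_dir {X : VField M} {f : M → ℝ} {U : Set M} {n m : WithTop ℕ∞} (hU : IsOpen U)
    (hX : ContMDiff (𝓡 4) (𝓡 4).tangent n (T% X)) (hf : ContMDiffOn (𝓡 4) 𝓘(ℝ) m f U)
    (hmn : n + 1 ≤ m) : ContMDiffOn (𝓡 4) 𝓘(ℝ) n (dir X f) U := by
  -- `X f` is the fibre component of the tangent map of `f` composed with the section `X`; this
  -- costs one order of differentiability.
  have h1 : ContMDiffOn (𝓡 4).tangent 𝓘(ℝ).tangent n (tangentMapWithin (𝓡 4) 𝓘(ℝ) f U)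
      (Bundle.TotalSpace.proj ⁻¹' U) :=
    hf.contMDiffOn_tangentMapWithin hmn hU.uniqueMDiffOn
  have h2 := h1.comp (hX.contMDiffOn (s := U)) (fun x hx => hx)
  have h3 := ((contMDiff_snd_tangentBundle_modelSpace (n := n) ℝ 𝓘(ℝ)).comp_contMDiffOn h2)
  refine h3.congr fun x hx => ?_
  have : mfderivWithin (𝓡 4) 𝓘(ℝ) f U x = mfderiv (𝓡 4) 𝓘(ℝ) f x :=
    mfderivWithin_of_isOpen hU hx
  simp only [Function.comp, tangentMapWithin, this]
  rfl

/-- The bracket of vector fields is the commutator of derivations. -/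
theorem dir_brk {X Y Z : VField M} {f : M → ℝ} {x : M}
    (hX : ContMDiff (𝓡 4) (𝓡 4).tangent 2 (T% X)) (hY : ContMDiff (𝓡 4) (𝓡 4).tangent 2 (T% Y))
    (hZ : ContMDiff (𝓡 4) (𝓡 4).tangent 2 (T% Z)) (hZx : Z x ≠ 0)
    (hf : ContMDiffAt (𝓡 4) 𝓘(ℝ) 2 f x)
    (hfe : ∀ᶠ y in 𝓝 x, MDifferentiableAt (𝓡 4) 𝓘(ℝ) f y)
    (hXf : MDifferentiableAt (𝓡 4) 𝓘(ℝ) (dir X f) x)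
    (hYf : MDifferentiableAt (𝓡 4) 𝓘(ℝ) (dir Y f) x) :
    dir (brk X Y) f x = dir X (dir Y f) x - dir Y (dir X f) x := by
  have hmin : minSmoothness ℝ 2 = 2 := minSmoothness_of_isRCLikeNormedField
  have hmin' : minSmoothness ℝ (1 + 1) = 2 := by
    rw [minSmoothness_of_isRCLikeNormedField]; norm_num
  have hZd : ∀ y, MDifferentiableAt (𝓡 4) (𝓡 4).tangent (T% Z) y :=
    hZ.mdifferentiable (by norm_num)
  have : IsManifold (𝓡 4) ((2 : ℕ∞) + 1) M := IsManifold.of_le (n := ∞) (by exact_mod_cast le_top)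
  have hbrk : ∀ {V : VField M}, ContMDiff (𝓡 4) (𝓡 4).tangent 2 (T% V) →
      MDifferentiableAt (𝓡 4) (𝓡 4).tangent (T% (brk V Z)) x := by
    intro V hV
    exact (ContMDiffAt.mlieBracket_vectorField (m := 1) (n := 2) (hV x) (hZ x)
      hmin'.le).mdifferentiableAt (by norm_num)
  have hfx := hfe.self_of_nhds
  have key : ∀ (V : VField M) (y : M), MDifferentiableAt (𝓡 4) 𝓘(ℝ) f y →
      brk V (f • Z) y = dir V f y • Z y + f y • brk V Z y := fun V y hy =>
    VectorField.mlieBracket_smul_right hy (hZd y)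
  have key2 : ∀ {V W : VField M}, ContMDiff (𝓡 4) (𝓡 4).tangent 2 (T% W) →
      MDifferentiableAt (𝓡 4) 𝓘(ℝ) (dir W f) x →
      brk V (brk W (f • Z)) x = dir V (dir W f) x • Z x + dir W f x • brk V Z x
        + (dir V f x • brk W Z x + f x • brk V (brk W Z) x) := by
    intro V W hW hWf
    have he : brk W (f • Z) =ᶠ[𝓝 x] (dir W f • Z + f • brk W Z) := by
      filter_upwards [hfe] with y hy using key W y hy
    have h1 : brk V (brk W (f • Z)) x = brk V (dir W f • Z + f • brk W Z) x :=
      (EventuallyEq.refl _ V).mlieBracket_vectorField_eq he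
    have h2 : brk V (dir W f • Z + f • brk W Z) x =
        brk V (dir W f • Z) x + brk V (f • brk W Z) x :=
      VectorField.mlieBracket_add_right (hWf.smul_section (hZd x))
        (hfx.smul_section (hbrk hW))
    have h3 : brk V (dir W f • Z) x = dir V (dir W f) x • Z x + dir W f x • brk V Z x :=
      VectorField.mlieBracket_smul_right hWf (hZd x)
    have h4 : brk V (f • brk W Z) x = dir V f x • brk W Z x + f x • brk V (brk W Z) x :=
      VectorField.mlieBracket_smul_right hfx (hbrk hW)
    rw [h1, h2, h3, h4]
  have hfZ : ContMDiffAt (𝓡 4) (𝓡 4).tangent 2 (T% (f • Z)) x := hf.smul_section (hZ x)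
  -- The auxiliary field `Z` carries the function. Expanding the Jacobi identity for `X`, `Y`, `f •
  -- Z` by the Leibniz rule and cancelling the one for `X`, `Y`, `Z` leaves the desired identity
  -- times `Z x`, which is nonzero.
  have jac : brk X (brk Y (f • Z)) x =
      brk (brk X Y) (f • Z) x + brk Y (brk X (f • Z)) x :=
    VectorField.leibniz_identity_mlieBracket_apply (by rw [hmin]; exact hX x)
      (by rw [hmin]; exact hY x) (by rw [hmin]; exact hfZ)
  have jac' : brk X (brk Y Z) x = brk (brk X Y) Z x + brk Y (brk X Z) x :=
    VectorField.leibniz_identity_mlieBracket_apply (by rw [hmin]; exact hX x)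
      (by rw [hmin]; exact hY x) (by rw [hmin]; exact hZ x)
  rw [key2 hY hYf, key2 hX hXf, key _ _ hfx, jac'] at jac
  have h0 : (dir (brk X Y) f x - (dir X (dir Y f) x - dir Y (dir X f) x)) • Z x = 0 := by
    rw [← sub_eq_zero] at jac
    rw [← neg_eq_zero, ← jac]
    module
  exact sub_eq_zero.1 ((smul_eq_zero.1 h0).resolve_right hZx)

namespace IsConstantFrame

variable {g : FormField M} {E : Fin 4 → VField M} {C : Fin 4 → Fin 4 → Fin 4 → ℝ}

theorem ne_zero (hE : IsConstantFrame g E C) (i : Fin 4) (x : M) : E i x ≠ 0 := by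
  intro h
  have := hE.orthonormal x i i
  simp [h] at this

theorem dir_frame_comm (hE : IsConstantFrame g E C) {f : M → ℝ} {U : Set M} (hU : IsOpen U)
    (hf : ContMDiffOn (𝓡 4) 𝓘(ℝ) 2 f U)
    (hfd : ∀ i, ∀ x ∈ U, MDifferentiableAt (𝓡 4) 𝓘(ℝ) (dir (E i) f) x)
    (i j : Fin 4) {x : M} (hx : x ∈ U) :
    dir (E i) (dir (E j) f) x - dir (E j) (dir (E i) f) x = ∑ k, C i j k * dir (E k) f x := by
  rw [← dir_brk (hE.smooth i) (hE.smooth j) (hE.smooth 0) (hE.ne_zero 0 x)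
    (hf.contMDiffAt (hU.mem_nhds hx))
    (eventually_of_mem (hU.mem_nhds hx) fun y hy =>
      (hf.contMDiffAt (hU.mem_nhds hy)).mdifferentiableAt (by norm_num)) (hfd i x hx) (hfd j x hx),
    hE.brk_eq, lin, dir_comb]

end IsConstantFrame
end BachFlat

/-! ### Curvature in a frame -/

namespace BachFlat

open Filter Topology

section Algebraic

variable (C : Fin 4 → Fin 4 → Fin 4 → ℝ)

/-- The curvature operator on the Lie algebra. -/
def curvC (a b c : Fin 4 → ℝ) : Fin 4 → ℝ :=
  conn C a (conn C b c) - conn C b (conn C a c) - conn C (lieC C a b) c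

/-- The Ricci tensor on the Lie algebra. -/
def ricC (a b : Fin 4 → ℝ) : ℝ := ∑ p, curvC C (Pi.single p 1) a b p

/-- The covariant derivative of the Ricci tensor on the Lie algebra. -/
def nablaRicC (a b c : Fin 4 → ℝ) : ℝ := -ricC C (conn C a b) c - ricC C b (conn C a c)

/-- The second covariant derivative of the Ricci tensor on the Lie algebra. -/
def nablaNablaRicC (a b c d : Fin 4 → ℝ) : ℝ :=
  -nablaRicC C (conn C a b) c d - nablaRicC C b (conn C a c) d - nablaRicC C b c (conn C a d)

/-- The coefficients of `∇_a b` for the metric conformally changed by a function with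
gradient `u`. -/
def connGrad (u a b : Fin 4 → ℝ) : Fin 4 → ℝ := fun l =>
  (∑ k, a k * u k) * b l + (∑ k, b k * u k) * a l - (∑ k, a k * b k) * u l + conn C a b l

/-- The coefficients of the curvature of the frame for the conformally changed metric, in terms of
the gradient `u` and the second derivatives `D`. -/
def curvGrad (u : Fin 4 → ℝ) (D : Fin 4 → Fin 4 → ℝ) (p i j : Fin 4) : Fin 4 → ℝ := fun l =>
  (D p i * (Pi.single j 1 : Fin 4 → ℝ) l + D p j * (Pi.single i 1 : Fin 4 → ℝ) l
      - (if i = j then 1 else 0) * D p l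
    + connGrad C u (Pi.single p 1) (connGrad C u (Pi.single i 1) (Pi.single j 1)) l)
  - (D i p * (Pi.single j 1 : Fin 4 → ℝ) l + D i j * (Pi.single p 1 : Fin 4 → ℝ) l
      - (if p = j then 1 else 0) * D i l
    + connGrad C u (Pi.single i 1) (connGrad C u (Pi.single p 1) (Pi.single j 1)) l)
  - connGrad C u (lieC C (Pi.single p 1) (Pi.single i 1)) (Pi.single j 1) l

end Algebraic

namespace IsConstantFrame

variable {M : Type*} [TopologicalSpace M] [ChartedSpace (EuclideanSpace ℝ (Fin 4)) M]
  {g : FormField M} {E : Fin 4 → VField M} {C : Fin 4 → Fin 4 → Fin 4 → ℝ}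

/-! #### The metric itself -/

theorem conformal_zero (g : FormField M) : conformal (fun _ => 0) g = g := by
  funext x
  simp [conformal]

theorem lin_sub (E : Fin 4 → VField M) (a b : Fin 4 → ℝ) (x : M) :
    lin E a x - lin E b x = lin E (a - b) x := by
  simp [lin, comb, sub_smul]

variable [IsManifold (𝓡 4) ∞ M]

theorem brk_lin (hE : IsConstantFrame g E C) (a b : Fin 4 → ℝ) :
    brk (lin E a) (lin E b) = lin E (lieC C a b) := by
  funext x
  have := hE.brk_comb (a := fun k _ => a k) (b := fun k _ => b k) (x := x)
    (fun _ => mdifferentiableAt_const) (fun _ => mdifferentiableAt_const)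
  exact this.trans (by simp [comb, lin, dir_const])

theorem nabla_lin (hE : IsConstantFrame g E C) (a b : Fin 4 → ℝ) :
    nabla g E (lin E a) (lin E b) = lin E (conn C a b) := by
  funext x
  have h := hE.nabla_conformal (f := fun _ => 0) a (h := fun k _ => b k) (x := x)
    mdifferentiableAt_const (fun _ => mdifferentiableAt_const)
  rw [conformal_zero] at h
  exact h.trans (by simp [comb, lin, connConf, dir_const])

theorem curv_lin (hE : IsConstantFrame g E C) (a b c : Fin 4 → ℝ) :
    curv g E (lin E a) (lin E b) (lin E c) = lin E (curvC C a b c) := by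
  funext x
  simp only [curv, hE.nabla_lin, hE.brk_lin, lin_sub, curvC]

theorem pair_lin (hE : IsConstantFrame g E C) (a b : Fin 4 → ℝ) :
    pair g (lin E a) (lin E b) = fun _ => ∑ k, a k * b k := hE.pair_comb _ _

theorem pair_lin_frame (hE : IsConstantFrame g E C) (a : Fin 4 → ℝ) (k : Fin 4) :
    pair g (lin E a) (E k) = fun _ => a k := by
  rw [← lin_single E k, hE.pair_lin]
  simp [Pi.single_apply]

theorem gInv_eq (hE : IsConstantFrame g E C) (i j : Fin 4) (x : M) :
    gInv g E i j x = if i = j then 1 else 0 := by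
  have := hE.gInv_conformal (fun _ => 0) i j x
  rw [conformal_zero] at this
  simpa using this

theorem ricci_lin (hE : IsConstantFrame g E C) (a b : Fin 4 → ℝ) :
    ricci g E (lin E a) (lin E b) = fun _ => ricC C a b := by
  funext x
  simp only [ricci, hE.gInv_eq]
  simp only [ite_mul, one_mul, zero_mul, Finset.sum_ite_eq, Finset.mem_univ, if_true, ricC]
  refine Finset.sum_congr rfl fun p _ => ?_
  have h := hE.curv_lin (Pi.single p 1) a b
  rw [lin_single] at h
  rw [h, hE.pair_lin_frame]

theorem nablaRicci_lin (hE : IsConstantFrame g E C) (a b c : Fin 4 → ℝ) :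
    nablaRicci g E (lin E a) (lin E b) (lin E c) = fun _ => nablaRicC C a b c := by
  funext x
  simp [nablaRicci, hE.ricci_lin, hE.nabla_lin, dir_const, nablaRicC]

theorem nablaNablaRicci_lin (hE : IsConstantFrame g E C) (a b c d : Fin 4 → ℝ) :
    nablaNablaRicci g E (lin E a) (lin E b) (lin E c) (lin E d) =
      fun _ => nablaNablaRicC C a b c d := by
  funext x
  simp [nablaNablaRicci, hE.nablaRicci_lin, hE.nabla_lin, dir_const, nablaNablaRicC]

/-! #### Conformal changes of the metric -/

theorem curv_conformal (hE : IsConstantFrame g E C) {f : M → ℝ} {U : Set M} (hU : IsOpen U)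
    (hf : ContMDiffOn (𝓡 4) 𝓘(ℝ) 2 f U)
    (hfd : ∀ i, ∀ x ∈ U, MDifferentiableAt (𝓡 4) 𝓘(ℝ) (dir (E i) f) x)
    (p i j : Fin 4) {x : M} (hx : x ∈ U) :
    curv (conformal f g) E (E p) (E i) (E j) x =
      ∑ k, curvGrad C (fun k => dir (E k) f x) (fun a b => dir (E a) (dir (E b) f) x) p i j k
        • E k x := by
  have hfm : ∀ y ∈ U, MDifferentiableAt (𝓡 4) 𝓘(ℝ) f y := fun y hy =>
    (hf.contMDiffAt (hU.mem_nhds hy)).mdifferentiableAt (by norm_num)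
  -- On `U`, the covariant derivative of constant combinations depends on `f` only through its
  -- gradient.
  have hlin : ∀ (a b : Fin 4 → ℝ), ∀ y ∈ U, nabla (conformal f g) E (lin E a) (lin E b) y =
      comb E (fun l y => connGrad C (fun k => dir (E k) f y) a b l) y := by
    intro a b y hy
    have h := hE.nabla_conformal (f := f) a (h := fun k _ => b k) (x := y) (hfm y hy)
      (fun _ => mdifferentiableAt_const)
    refine h.trans ?_
    simp only [comb, connConf, connGrad, dir_const, zero_add]
    refine Finset.sum_congr rfl fun l _ => ?_
    rw [lin, dir_comb, dir_comb]
  have hd : ∀ a b l, ∀ y ∈ U, MDifferentiableAt (𝓡 4) 𝓘(ℝ)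
      (fun y => connGrad C (fun k => dir (E k) f y) a b l) y := by
    intro a b l y hy
    have hs : ∀ c : Fin 4 → ℝ, MDifferentiableAt (𝓡 4) 𝓘(ℝ)
        (fun y => ∑ k, c k * dir (E k) f y) y := fun c =>
      mdifferentiableAt_finset_sum _ fun k _ => mdifferentiableAt_const.mul (hfd k y hy)
    exact ((((hs a).mul mdifferentiableAt_const).add ((hs b).mul mdifferentiableAt_const)).sub
      (mdifferentiableAt_const.mul (hfd l y hy))).add mdifferentiableAt_const
  have hnn : ∀ a b c : Fin 4, nabla (conformal f g) E (E a)
      (nabla (conformal f g) E (E b) (E c)) x = comb E (fun l y =>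
        dir (E a) (dir (E b) f) y * (Pi.single c 1 : Fin 4 → ℝ) l
        + dir (E a) (dir (E c) f) y * (Pi.single b 1 : Fin 4 → ℝ) l
        - (if b = c then 1 else 0) * dir (E a) (dir (E l) f) y
        + connGrad C (fun k => dir (E k) f y) (Pi.single a 1)
          (connGrad C (fun k => dir (E k) f y) (Pi.single b 1) (Pi.single c 1)) l) x := by
    intro a b c
    have he : nabla (conformal f g) E (E b) (E c) =ᶠ[𝓝 x]
        comb E (fun l y => connGrad C (fun k => dir (E k) f y) (Pi.single b 1)
          (Pi.single c 1) l) := by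
      filter_upwards [hU.mem_nhds hx] with y hy
      have := hlin (Pi.single b 1) (Pi.single c 1) y hy
      rwa [lin_single, lin_single] at this
    rw [nabla_congr _ _ he]
    have h := hE.nabla_conformal (f := f) (Pi.single a 1)
      (h := fun l y => connGrad C (fun k => dir (E k) f y) (Pi.single b 1) (Pi.single c 1) l)
      (x := x) (hfm x hx) (fun l => hd _ _ l x hx)
    rw [lin_single] at h
    rw [h]
    simp only [comb]
    refine Finset.sum_congr rfl fun l _ => ?_
    congr 1
    -- The coefficients of `∇_{E b} E c` are affine in the gradient with constant coefficients.
    -- Differentiating along `E a` drops the constant and replaces each first derivative of `f` by a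
    -- second one.
    have hder : dir (E a) (fun y => connGrad C (fun k => dir (E k) f y) (Pi.single b 1)
        (Pi.single c 1) l) x =
        dir (E a) (dir (E b) f) x * (Pi.single c 1 : Fin 4 → ℝ) l
        + dir (E a) (dir (E c) f) x * (Pi.single b 1 : Fin 4 → ℝ) l
        - (if b = c then 1 else 0) * dir (E a) (dir (E l) f) x := by
      have hfun : (fun y => connGrad C (fun k => dir (E k) f y) (Pi.single b 1)
          (Pi.single c 1) l) = fun y => (((Pi.single c 1 : Fin 4 → ℝ) l * dir (E b) f y
            + (Pi.single b 1 : Fin 4 → ℝ) l * dir (E c) f y)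
            + (-(if b = c then 1 else 0)) * dir (E l) f y)
            + conn C (Pi.single b 1) (Pi.single c 1) l := by
        funext y
        simp [connGrad, Pi.single_apply, eq_comm, mul_comm]
        ring
      have hm : ∀ (r : ℝ) (k : Fin 4), MDifferentiableAt (𝓡 4) 𝓘(ℝ)
          (fun y => r * dir (E k) f y) x := fun r k => mdifferentiableAt_const.mul (hfd k x hx)
      have hm₂ : ∀ r s : ℝ, MDifferentiableAt (𝓡 4) 𝓘(ℝ)
          (fun y => r * dir (E b) f y + s * dir (E c) f y) x := fun r s => (hm r b).add (hm s c)
      have hm₃ : ∀ r s t : ℝ, MDifferentiableAt (𝓡 4) 𝓘(ℝ)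
          (fun y => r * dir (E b) f y + s * dir (E c) f y + t * dir (E l) f y) x :=
        fun r s t => (hm₂ r s).add (hm t l)
      rw [hfun, dir_add (hm₃ _ _ _) mdifferentiableAt_const,
        dir_add (hm₂ _ _) (hm _ l), dir_add (hm _ b) (hm _ c),
        dir_mul mdifferentiableAt_const (hfd b x hx),
        dir_mul mdifferentiableAt_const (hfd c x hx),
        dir_mul mdifferentiableAt_const (hfd l x hx)]
      simp only [dir_const]
      ring
    simp only [connConf, hder, dir_comb, lin_single]
    have hexp : ∀ w : Fin 4 → ℝ, connGrad C (fun k => dir (E k) f x) (Pi.single a 1) w l =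
        dir (E a) f x * w l + (∑ k, w k * dir (E k) f x) * (Pi.single a 1 : Fin 4 → ℝ) l
          - (∑ k, (Pi.single a 1 : Fin 4 → ℝ) k * w k) * dir (E l) f x
          + conn C (Pi.single a 1) w l := by
      intro w
      simp [connGrad, Pi.single_apply]
    rw [hexp]
    ring
  have hb : brk (E p) (E i) = lin E (lieC C (Pi.single p 1) (Pi.single i 1)) := by
    rw [← hE.brk_lin, lin_single, lin_single]
  have h3 := hlin (lieC C (Pi.single p 1) (Pi.single i 1)) (Pi.single j 1) x hx
  rw [lin_single] at h3
  simp only [curv]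
  rw [hb, h3, hnn p i j, hnn i p j]
  simp only [comb, ← Finset.sum_sub_distrib, ← sub_smul]
  rfl

theorem ricci_conformal_eq (hE : IsConstantFrame g E C) {f : M → ℝ} {U : Set M} (hU : IsOpen U)
    (hf : ContMDiffOn (𝓡 4) 𝓘(ℝ) 2 f U)
    (hfd : ∀ i, ∀ x ∈ U, MDifferentiableAt (𝓡 4) 𝓘(ℝ) (dir (E i) f) x)
    (i j : Fin 4) {x : M} (hx : x ∈ U) :
    ricci (conformal f g) E (E i) (E j) x = ∑ p, curvGrad C (fun k => dir (E k) f x)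
      (fun a b => dir (E a) (dir (E b) f) x) p i j p :=
  hE.ricci_conformal fun p => hE.curv_conformal hU hf hfd p i j hx

end IsConstantFrame
end BachFlat

/-! ### Curvature of the Lie algebra -/

namespace BachFlat

section Computation

variable (s t : ℝ)

/-- The bracket on `ℝ⁴` with `de³ = s e¹∧e³ + e²∧e³ - t e²∧e⁴` and
`de⁴ = s e¹∧e⁴ - e²∧e⁴ + t e²∧e³`. -/
def bracketR (a b : Fin 4 → ℝ) : Fin 4 → ℝ :=
  ![0, 0,
    -(s * (a 0 * b 2 - a 2 * b 0) + (a 1 * b 2 - a 2 * b 1) - t * (a 1 * b 3 - a 3 * b 1)),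
    -(s * (a 0 * b 3 - a 3 * b 0) - (a 1 * b 3 - a 3 * b 1) + t * (a 1 * b 2 - a 2 * b 1))]

/-- The structure constants of the bracket `bracketR`. -/
def structConst (i j : Fin 4) : Fin 4 → ℝ := bracketR s t (Pi.single i 1) (Pi.single j 1)

theorem lieC_structConst (a b : Fin 4 → ℝ) : lieC (structConst s t) a b = bracketR s t a b := by
  funext k
  fin_cases k <;> simp [lieC, structConst, bracketR, Fin.sum_univ_four] <;> ring

theorem conn_structConst (a b : Fin 4 → ℝ) : conn (structConst s t) a b =
    ![-s * (a 2 * b 2 + a 3 * b 3), a 3 * b 3 - a 2 * b 2,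
      t * a 1 * b 3 + s * a 2 * b 0 + a 2 * b 1, -t * a 1 * b 2 + s * a 3 * b 0 - a 3 * b 1] := by
  funext k
  fin_cases k <;> simp [conn, lieC_structConst, bracketR, Fin.sum_univ_four] <;> ring

theorem ricC_structConst (a b : Fin 4 → ℝ) : ricC (structConst s t) a b =
    -2 * s ^ 2 * (a 0 * b 0) - 2 * (a 1 * b 1) - 2 * s ^ 2 * (a 2 * b 2 + a 3 * b 3)
      + 2 * t * (a 2 * b 3 + a 3 * b 2) := by
  simp [ricC, curvC, conn_structConst, lieC_structConst, bracketR, Fin.sum_univ_four]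
  ring

/-- A closed form for the first covariant derivative reduces the second one in the Bach tensor to
substitution. -/
theorem nablaRicC_structConst (a b c : Fin 4 → ℝ) : nablaRicC (structConst s t) a b c =
    2 * (s ^ 2 - 1) * (a 2 * (b 1 * c 2 + b 2 * c 1) - a 3 * (b 1 * c 3 + b 3 * c 1))
      + 4 * t ^ 2 * a 1 * (b 2 * c 2 - b 3 * c 3)
      - 2 * t * s * (a 2 * (b 3 * c 0 + b 0 * c 3) + a 3 * (b 0 * c 2 + b 2 * c 0))
      - 2 * t * (a 2 * (b 3 * c 1 + b 1 * c 3) - a 3 * (b 1 * c 2 + b 2 * c 1)) := by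
  simp [nablaRicC, ricC_structConst, conn_structConst]
  ring

variable {s t}

theorem bach_structConst (hs : s ^ 2 = 2) (ht : t ^ 2 = 1 / 3) (i j : Fin 4) :
    (∑ p, nablaNablaRicC (structConst s t) (Pi.single p 1) (Pi.single j 1) (Pi.single i 1)
        (Pi.single p 1))
      - (1 / 2) * (∑ p, nablaNablaRicC (structConst s t) (Pi.single p 1) (Pi.single p 1)
        (Pi.single i 1) (Pi.single j 1))
      + (1 / 3) * ((∑ p, ricC (structConst s t) (Pi.single p 1) (Pi.single p 1))
        * ricC (structConst s t) (Pi.single i 1) (Pi.single j 1))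
      - (∑ p, ricC (structConst s t) (Pi.single p 1) (Pi.single i 1)
        * ricC (structConst s t) (Pi.single p 1) (Pi.single j 1))
      + (1 / 12) * ((3 * (∑ p, ∑ q, ricC (structConst s t) (Pi.single p 1) (Pi.single q 1)
        * ricC (structConst s t) (Pi.single p 1) (Pi.single q 1))
        - (∑ p, ricC (structConst s t) (Pi.single p 1) (Pi.single p 1)) ^ 2)
        * if i = j then 1 else 0) = 0 := by
  simp only [nablaNablaRicC, nablaRicC_structConst, ricC_structConst, conn_structConst, hs, ht,
    Fin.sum_univ_four]
  -- Multiplying out can produce new occurrences of `s ^ 2` and `t ^ 2`, hence the second use of the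
  -- two relations.
  fin_cases i <;> fin_cases j <;> simp <;> ring_nf <;>
    simp only [hs, ht] <;> ring_nf

/-- Off the diagonal, the Ricci tensor of `e^{2f} g` is `ρ - 2(Hess f - df ⊗ df)`, so its vanishing
determines the Hessian there. The term `t` is half of `ρ(e₃, e₄) = 2t`, and the linear terms `±u`
come from the connection. The commutation relations `hc` reconcile the two orders of differentiation
in the trace. -/
theorem ric_conformal_off_diagonal {u : Fin 4 → ℝ} {D : Fin 4 → Fin 4 → ℝ}
    (hc : ∀ i j, D i j - D j i = ∑ k, structConst s t i j k * u k)
    (hr : ∀ i j, i ≠ j → ∑ p, curvGrad (structConst s t) u D p i j p = 0) :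
    D 2 1 = u 2 + u 1 * u 2 ∧ D 3 1 = u 1 * u 3 - u 3 ∧ D 3 2 = u 2 * u 3 + t ∧
      D 2 3 = u 2 * u 3 + t := by
  have h21 := hr 2 1 (by decide)
  have h31 := hr 3 1 (by decide)
  have h32 := hr 3 2 (by decide)
  have h23 := hr 2 3 (by decide)
  have c21 := hc 2 1
  have c31 := hc 3 1
  have c32 := hc 3 2
  simp [curvGrad, connGrad, lieC_structConst, conn_structConst, bracketR, Fin.sum_univ_four,
    Pi.single_apply] at h21 h31 h32 h23
  simp [structConst, bracketR, Fin.sum_univ_four] at c21 c31 c32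
  refine ⟨?_, ?_, ?_, ?_⟩
  · linarith
  · linarith
  · linarith
  · linarith

end Computation
end BachFlat

/-! ### Non-trivial Bach-flatness -/

namespace BachFlat

open Filter Topology

namespace IsConstantFrame

variable {M : Type*} [TopologicalSpace M] [ChartedSpace (EuclideanSpace ℝ (Fin 4)) M]
  [IsManifold (𝓡 4) ∞ M] {g : FormField M} {E : Fin 4 → VField M}

section General

variable {C : Fin 4 → Fin 4 → Fin 4 → ℝ}

theorem pair_frame (hE : IsConstantFrame g E C) (i j : Fin 4) :
    pair g (E i) (E j) = fun _ => if i = j then 1 else 0 := by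
  funext x
  exact hE.orthonormal x i j

theorem ricci_frame (hE : IsConstantFrame g E C) (i j : Fin 4) (x : M) :
    ricci g E (E i) (E j) x = ricC C (Pi.single i 1) (Pi.single j 1) := by
  rw [← lin_single E i, ← lin_single E j, hE.ricci_lin]

theorem scal_eq (hE : IsConstantFrame g E C) (x : M) :
    scal g E x = ∑ p, ricC C (Pi.single p 1) (Pi.single p 1) := by
  simp [scal, hE.gInv_eq, hE.ricci_frame]

theorem ricciNormSq_eq (hE : IsConstantFrame g E C) (x : M) :
    ricciNormSq g E x = ∑ p, ∑ q, ricC C (Pi.single p 1) (Pi.single q 1)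
      * ricC C (Pi.single p 1) (Pi.single q 1) := by
  simp [ricciNormSq, hE.gInv_eq, hE.ricci_frame]

theorem nablaNablaRicci_frame (hE : IsConstantFrame g E C) (i j k l : Fin 4) (x : M) :
    nablaNablaRicci g E (E i) (E j) (E k) (E l) x =
      nablaNablaRicC C (Pi.single i 1) (Pi.single j 1) (Pi.single k 1) (Pi.single l 1) := by
  rw [← congrFun (hE.nablaNablaRicci_lin _ _ _ _) x]
  simp only [lin_single]

theorem curv_frame (hE : IsConstantFrame g E C) (i j k l : Fin 4) (x : M) :
    pair g (curv g E (E i) (E j) (E k)) (E l) x =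
      curvC C (Pi.single i 1) (Pi.single j 1) (Pi.single k 1) l := by
  have h := hE.curv_lin (Pi.single i 1) (Pi.single j 1) (Pi.single k 1)
  simp only [lin_single] at h
  rw [h, hE.pair_lin_frame]

end General

/-! ### Bach tensor, Weyl tensor and the conformally Einstein condition -/

variable {s t : ℝ}

theorem isBachFlat (hE : IsConstantFrame g E (structConst s t)) (hs : s ^ 2 = 2)
    (ht : t ^ 2 = 1 / 3) : IsBachFlat g E := by
  intro x i j
  rw [← bach_structConst hs ht i j]
  simp only [bach, hE.gInv_eq, hE.nablaNablaRicci_frame, hE.ricci_frame, hE.scal_eq,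
    hE.ricciNormSq_eq, hE.pair_frame]
  simp only [ite_mul, one_mul, zero_mul, Finset.sum_ite_eq, Finset.mem_univ, if_true]

/-- The plane of `E 0` and `E 1` is flat, so only the sum of the Schouten components `00` and `11`
contributes. -/
theorem weyl_zero_one (hE : IsConstantFrame g E (structConst s t)) (hs : s ^ 2 = 2)
    (x : M) : weyl g E (E 0) (E 1) (E 0) (E 1) x = -2 / 3 := by
  simp only [weyl, schouten, hE.curv_frame, hE.ricci_frame, hE.scal_eq, hE.pair_frame, curvC,
    ricC_structConst, conn_structConst, lieC_structConst, bracketR, Fin.sum_univ_four, hs]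
  simp
  norm_num

theorem weyl_two_or_three (hE : IsConstantFrame g E (structConst s t)) {m : Fin 4}
    (hm : m = 2 ∨ m = 3) (n : Fin 4) (x : M) :
    weyl g E (E m) (E n) (E 0) (E 1) x = 0 := by
  simp only [weyl, schouten, hE.curv_frame, hE.ricci_frame, hE.scal_eq, hE.pair_frame, curvC,
    ricC_structConst, conn_structConst, lieC_structConst, bracketR, Fin.sum_univ_four]
  rcases hm with rfl | rfl <;> fin_cases n <;> simp

theorem levi_eq_zero {m : Fin 4} (hm : m = 0 ∨ m = 1) (n : Fin 4) : levi 0 1 m n = 0 := by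
  rcases hm with rfl | rfl
  · exact Matrix.det_zero_of_row_eq (i := 0) (j := 2) (by decide) rfl
  · exact Matrix.det_zero_of_row_eq (i := 1) (j := 2) (by decide) rfl

/-- The star sends `E₀ ∧ E₁` to `E₂ ∧ E₃`. Terms with `m ∈ {0, 1}` die by the Levi-Civita symbol,
the others by the vanishing of the Weyl component. -/
theorem starWeyl_zero_one (hE : IsConstantFrame g E (structConst s t))
    (x : M) : starWeyl g E 0 1 0 1 x = 0 := by
  simp only [starWeyl, hE.gInv_eq]
  refine mul_eq_zero_of_right _ (Finset.sum_eq_zero fun m _ => Finset.sum_eq_zero fun n _ =>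
    Finset.sum_eq_zero fun p _ => Finset.sum_eq_zero fun q _ => ?_)
  have hm : (m = 0 ∨ m = 1) ∨ m = 2 ∨ m = 3 := by revert m; decide
  rcases hm with hm | hm
  · rw [levi_eq_zero hm]; ring
  · by_cases hp : m = p
    · subst hp; rw [hE.weyl_two_or_three hm]; ring
    · simp [hp]

theorem not_isHalfConformallyFlatOn (hE : IsConstantFrame g E (structConst s t)) (hs : s ^ 2 = 2)
    {U : Set M} (hU : U.Nonempty) : ¬ IsHalfConformallyFlatOn g E U := by
  obtain ⟨x, hx⟩ := hU
  rintro (h | h)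
  · have := h x hx 0 1 0 1
    rw [weylPlus, hE.weyl_zero_one hs, hE.starWeyl_zero_one] at this
    norm_num at this
  · have := h x hx 0 1 0 1
    rw [weylMinus, hE.weyl_zero_one hs, hE.starWeyl_zero_one] at this
    norm_num at this

theorem not_isConformallyEinsteinOn (hE : IsConstantFrame g E (structConst s t)) (ht : t ≠ 0)
    {U : Set M} (hU : IsOpen U) (hne : U.Nonempty) : ¬ IsConformallyEinsteinOn g E U := by
  rintro ⟨f, hf, c, hc⟩
  have hud : ∀ i, ContMDiffOn (𝓡 4) 𝓘(ℝ) 2 (dir (E i) f) U := fun i =>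
    contMDiffOn_dir hU (hE.smooth i) hf
      (by rw [show (2 : WithTop ℕ∞) + 1 = 3 by norm_num]; exact ENat.LEInfty.out)
  have hmd : ∀ i, ∀ x ∈ U, MDifferentiableAt (𝓡 4) 𝓘(ℝ) (dir (E i) f) x := fun i x hx =>
    ((hud i).contMDiffAt (hU.mem_nhds hx)).mdifferentiableAt (by norm_num)
  have hf2 : ContMDiffOn (𝓡 4) 𝓘(ℝ) 2 f U := hf.of_le ENat.LEInfty.out
  have key : ∀ x ∈ U, _ := fun x hx => ric_conformal_off_diagonal
    (u := fun k => dir (E k) f x) (D := fun a b => dir (E a) (dir (E b) f) x)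
    (fun i j => hE.dir_frame_comm hU hf2 hmd i j hx) (fun i j hij => by
      rw [← hE.ricci_conformal_eq hU hf2 hmd i j hx, hc x hx i j]
      simp [pair, conformal_apply, hE.orthonormal, hij])
  obtain ⟨x, hx⟩ := hne
  have hev : ∀ {p q : M → ℝ}, (∀ y ∈ U, p y = q y) → p =ᶠ[𝓝 x] q := fun h =>
    eventually_of_mem (hU.mem_nhds hx) h
  have h2 : dir (E 2) (dir (E 1) f) =ᶠ[𝓝 x]
      fun y => dir (E 2) f y + dir (E 1) f y * dir (E 2) f y :=
    hev fun y hy => (key y hy).1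
  have h3 : dir (E 3) (dir (E 1) f) =ᶠ[𝓝 x]
      fun y => dir (E 1) f y * dir (E 3) f y + -1 * dir (E 3) f y :=
    hev fun y hy => by rw [(key y hy).2.1]; ring
  have hm := fun i => hmd i x hx
  have hmm : ∀ i, MDifferentiableAt (𝓡 4) 𝓘(ℝ) (fun y => dir (E 1) f y * dir (E i) f y) x :=
    fun i => (hm 1).mul (hm i)
  have hm3 : MDifferentiableAt (𝓡 4) 𝓘(ℝ) (fun y => -1 * dir (E 3) f y) x :=
    mdifferentiableAt_const.mul (hm 3)
  have hmd2 : ∀ i, ∀ y ∈ U, MDifferentiableAt (𝓡 4) 𝓘(ℝ) (dir (E i) (dir (E 1) f)) y :=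
    fun i y hy => ((contMDiffOn_dir hU ((hE.smooth i).of_le one_le_two) (hud 1)
      one_add_one_eq_two.le).contMDiffAt (hU.mem_nhds hy)).mdifferentiableAt one_ne_zero
  -- The integrability condition: the commuting fields `E 3` and `E 2` are applied to `E₁ f`. After
  -- substitution all gradient terms cancel and `2t = 0` remains.
  have hcomm := hE.dir_frame_comm hU (hud 1) hmd2 3 2 hx
  rw [dir_congr h2, dir_congr h3, dir_add (hm 2) (hmm 2), dir_add (hmm 3) hm3,
    dir_mul (hm 1) (hm 2), dir_mul (hm 1) (hm 3),
    dir_mul mdifferentiableAt_const (hm 3), dir_const] at hcomm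
  obtain ⟨k21, k31, k32, k23⟩ := key x hx
  simp only [k21, k31, k32, k23] at hcomm
  simp [structConst, bracketR, Fin.sum_univ_four] at hcomm
  apply ht
  linarith

end IsConstantFrame
end BachFlat

namespace BachFlat

/-! ### The Lie algebra -/

theorem sqrtTwo_ne_zero : sqrtTwo ≠ 0 := by
  intro h
  have : √2 = 0 := congrArg Subtype.val h
  simp at this

theorem stdBasis_apply (i j : Fin 4) : stdBasis i j = if i = j then 1 else 0 := by
  have : stdBasis i = Pi.basisFun QSqrt (Fin 4) i := rfl
  rw [this, Pi.basisFun_apply, Pi.single_apply]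
  simp [eq_comm]

theorem finrank_alg : Module.finrank QSqrt Alg = 4 := by
  rw [Module.finrank_eq_card_basis stdBasis, Fintype.card_fin]

/-- The ideal spanned by `e₃` and `e₄`. -/
def planeIdeal : LieIdeal QSqrt Alg where
  carrier := {x | x 0 = 0 ∧ x 1 = 0}
  add_mem' := by
    rintro x y ⟨h0, h1⟩ ⟨k0, k1⟩
    simp [add_apply, *]
  zero_mem' := ⟨rfl, rfl⟩
  smul_mem' := by
    rintro c x ⟨h0, h1⟩
    simp [smul_apply, *]
  lie_mem := by
    intro x y _
    exact ⟨by simp [bracket_apply, dForm], by simp [bracket_apply, dForm]⟩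

theorem mem_planeIdeal {x : Alg} : x ∈ planeIdeal ↔ x 0 = 0 ∧ x 1 = 0 := Iff.rfl

theorem derivedSeries_one : LieAlgebra.derivedSeries QSqrt Alg 1 = planeIdeal := by
  have h : LieAlgebra.derivedSeries QSqrt Alg 1 =
      ⁅(⊤ : LieIdeal QSqrt Alg), (⊤ : LieIdeal QSqrt Alg)⁆ := by simp
  rw [h]
  apply le_antisymm
  · rw [LieSubmodule.lie_le_iff]
    intro x _ y _
    exact ⟨by simp [bracket_apply, dForm], by simp [bracket_apply, dForm]⟩
  · intro x hx
    -- `e₁` acts on the plane as the scalar `-√2`, so every vector of the plane is a single bracket.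
    have hx' : x = ⁅stdBasis 0, (-sqrtTwo⁻¹) • x⁆ := by
      obtain ⟨h0, h1⟩ := mem_planeIdeal.1 hx
      refine alg_ext fun i => ?_
      have := sqrtTwo_ne_zero
      fin_cases i <;>
        simp [-neg_smul, bracket_apply, dForm, wedge, smul_apply, stdBasis_apply, h0, h1, this]
    rw [hx']
    exact LieSubmodule.lie_mem_lie (LieSubmodule.mem_top _) (LieSubmodule.mem_top _)

theorem finrank_derivedSeries_one :
    Module.finrank QSqrt (LieAlgebra.derivedSeries QSqrt Alg 1) = 2 := by
  rw [derivedSeries_one]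
  let e : planeIdeal ≃ₗ[QSqrt] (Fin 2 → QSqrt) :=
    { toFun := fun x => ![(x : Alg) 2, (x : Alg) 3]
      invFun := fun v => ⟨(![0, 0, v 0, v 1] : Fin 4 → QSqrt), ⟨rfl, rfl⟩⟩
      map_add' := fun x y => by ext i; fin_cases i <;> rfl
      map_smul' := fun c x => by ext i; fin_cases i <;> rfl
      left_inv := fun x => by
        obtain ⟨h0, h1⟩ := mem_planeIdeal.1 x.2
        refine Subtype.ext (alg_ext fun i => ?_)
        fin_cases i
        · exact h0.symm
        · exact h1.symm
        · rfl
        · rfl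
      right_inv := fun v => by ext i; fin_cases i <;> rfl }
  rw [e.finrank_eq, Module.finrank_fin_fun]

theorem derivedSeries_two : LieAlgebra.derivedSeries QSqrt Alg 2 = ⊥ := by
  have h : LieAlgebra.derivedSeries QSqrt Alg 2 = ⁅planeIdeal, planeIdeal⁆ := by
    rw [← derivedSeries_one]
    simp
  rw [h, eq_bot_iff, LieSubmodule.lie_le_iff]
  rintro x ⟨h0, h1⟩ y ⟨k0, k1⟩
  rw [LieSubmodule.mem_bot]
  refine alg_ext fun i => ?_
  fin_cases i <;> simp [bracket_apply, dForm, wedge, zero_apply, h0, h1, k0, k1]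

theorem isSolvable_alg : LieAlgebra.IsSolvable Alg :=
  LieAlgebra.IsSolvable.mk derivedSeries_two

/-- The basis of `ℝ ⊗ 𝔤` given by `e₁, …, e₄`. -/
def realBasis : Module.Basis (Fin 4) ℝ (ℝ ⊗[QSqrt] Alg) :=
  Algebra.TensorProduct.basis ℝ stdBasis

theorem lie_stdBasis (i j : Fin 4) :
    ⁅stdBasis i, stdBasis j⁆ = ∑ k, (-dForm k (stdBasis i) (stdBasis j)) • stdBasis k := by
  rw [← stdBasis.sum_repr ⁅stdBasis i, stdBasis j⁆]
  rfl

theorem algebraMap_dForm (x y : Alg) (k : Fin 4) :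
    algebraMap QSqrt ℝ (-dForm k x y) = bracketR √2 (1 / √3)
      (fun i => algebraMap QSqrt ℝ (x i)) (fun i => algebraMap QSqrt ℝ (y i)) k := by
  have h2 : algebraMap QSqrt ℝ sqrtTwo = √2 := rfl
  have h3 : algebraMap QSqrt ℝ sqrtThree = √3 := rfl
  fin_cases k <;> simp only [dForm, wedge, bracketR]
  · simp
  · simp
  · simp only [Fin.reduceFinMk, Matrix.cons_val, map_neg, map_add, map_sub, map_mul, map_div₀,
      map_one, h2, h3]
  · simp only [Fin.reduceFinMk, Matrix.cons_val, map_neg, map_add, map_sub, map_mul, map_div₀,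
      map_one, h2, h3]

theorem algebraMap_dForm_stdBasis (i j k : Fin 4) :
    algebraMap QSqrt ℝ (-dForm k (stdBasis i) (stdBasis j)) = structConst √2 (1 / √3) i j k := by
  have h : ∀ l, (fun m => algebraMap QSqrt ℝ (stdBasis l m)) = Pi.single l 1 := by
    intro l
    funext m
    rw [stdBasis_apply, Pi.single_apply]
    by_cases hlm : l = m <;> simp [hlm, eq_comm]
  rw [algebraMap_dForm, h, h, structConst]

theorem lie_realBasis (i j : Fin 4) :
    ⁅realBasis i, realBasis j⁆ = ∑ k, structConst √2 (1 / √3) i j k • realBasis k := by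
  simp only [realBasis, Algebra.TensorProduct.basis_apply, LieAlgebra.ExtendScalars.bracket_tmul,
    lie_stdBasis, TensorProduct.tmul_sum, ← algebraMap_dForm_stdBasis]
  refine Finset.sum_congr rfl fun k _ => ?_
  rw [TensorProduct.tmul_smul, mul_one]
  exact (algebraMap_smul ℝ _ _).symm

/-- Real Lie algebras with bases having the same structure constants are isomorphic. -/
theorem nonempty_lieEquiv_of_basis {L L' ι : Type*} [LieRing L] [LieAlgebra ℝ L] [LieRing L']
    [LieAlgebra ℝ L'] [Fintype ι] (b : Module.Basis ι ℝ L) (c : Module.Basis ι ℝ L')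
    {C : ι → ι → ι → ℝ} (hb : ∀ i j, ⁅b i, b j⁆ = ∑ k, C i j k • b k)
    (hc : ∀ i j, ⁅c i, c j⁆ = ∑ k, C i j k • c k) : Nonempty (L ≃ₗ⁅ℝ⁆ L') := by
  let e := b.equiv c (Equiv.refl _)
  have he : ∀ i, e (b i) = c i := fun i => by simp [e]
  refine ⟨{ e with map_lie' := ?_ }⟩
  intro x y
  change e ⁅x, y⁆ = ⁅e x, e y⁆
  rw [← b.sum_repr x, ← b.sum_repr y]
  simp only [sum_lie, lie_sum, map_sum, smul_lie, lie_smul, map_smul, he, hb, hc]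

end BachFlat

/-! ### Left-invariant metrics -/

namespace BachFlat

open Filter Topology

section LeftInvariantMetric

variable {G : Type*} [TopologicalSpace G] [ChartedSpace (EuclideanSpace ℝ (Fin 4)) G] [Group G]

/-- The isomorphism of the Lie algebra with `ℝ⁴` given by a basis. -/
def coordEquiv (b : Module.Basis (Fin 4) ℝ (GroupLieAlgebra (𝓡 4) G)) :
    EuclideanSpace ℝ (Fin 4) ≃L[ℝ] EuclideanSpace ℝ (Fin 4) :=
  LinearEquiv.toContinuousLinearEquiv
    ((show Module.Basis (Fin 4) ℝ (EuclideanSpace ℝ (Fin 4)) from b).equivFun ≪≫ₗ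
      (WithLp.linearEquiv 2 ℝ (Fin 4 → ℝ)).symm)

theorem coordEquiv_apply (b : Module.Basis (Fin 4) ℝ (GroupLieAlgebra (𝓡 4) G)) (i : Fin 4) :
    coordEquiv b (b i) = EuclideanSpace.single i 1 := by
  have : (show Module.Basis (Fin 4) ℝ (EuclideanSpace ℝ (Fin 4)) from b).equivFun (b i) =
      Pi.single i 1 := by
    ext j
    exact ((show Module.Basis (Fin 4) ℝ (EuclideanSpace ℝ (Fin 4)) from b).equivFun_self i j).trans
      (by simp [Pi.single_apply, eq_comm])
  exact congrArg (WithLp.toLp 2) this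

/-- Left translation of tangent vectors to the identity. -/
def toOne (x : G) : EuclideanSpace ℝ (Fin 4) →L[ℝ] EuclideanSpace ℝ (Fin 4) :=
  mfderiv (𝓡 4) (𝓡 4) (fun y : G => x⁻¹ * y) x

/-- Left translation of tangent vectors from the identity. -/
def fromOne (x : G) : EuclideanSpace ℝ (Fin 4) →L[ℝ] EuclideanSpace ℝ (Fin 4) :=
  mfderiv (𝓡 4) (𝓡 4) (fun y : G => x * y) 1

/-- The inner product of `ℝ⁴`, as a bilinear form. -/
def innerForm : EuclideanSpace ℝ (Fin 4) →L[ℝ] EuclideanSpace ℝ (Fin 4) →L[ℝ] ℝ := innerSL ℝ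

/-- The inner product on the tangent space at `x` for which the left-invariant frame is
orthonormal. -/
def leftInner (b : Module.Basis (Fin 4) ℝ (GroupLieAlgebra (𝓡 4) G)) (x : G) :
    EuclideanSpace ℝ (Fin 4) →L[ℝ] EuclideanSpace ℝ (Fin 4) →L[ℝ] ℝ :=
  innerForm.bilinearComp ((coordEquiv b).toContinuousLinearMap.comp (toOne x))
    ((coordEquiv b).toContinuousLinearMap.comp (toOne x))

/-- The inner products `leftInner`, as a field of bilinear forms. -/
def leftForm (b : Module.Basis (Fin 4) ℝ (GroupLieAlgebra (𝓡 4) G)) : FormField G :=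
  fun x => leftInner b x

theorem leftForm_apply (b : Module.Basis (Fin 4) ℝ (GroupLieAlgebra (𝓡 4) G)) (x : G)
    (u v : TangentSpace (𝓡 4) x) :
    leftForm b x u v = inner ℝ (coordEquiv b (toOne x u)) (coordEquiv b (toOne x v)) := rfl

variable [LieGroup (𝓡 4) ∞ G]

/-! ### Differentials of left translations and smoothness of the metric -/

theorem mdifferentiableAt_mul_left (a x : G) :
    MDifferentiableAt (𝓡 4) (𝓡 4) (fun y : G => a * y) x :=
  (contMDiff_mul_left (I := 𝓡 4) (n := ∞) (a := a)).mdifferentiableAt (by simp)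

/-- The base point is a separate variable because composing translations produces points such as `x
* 1`, which equal `x` only propositionally. -/
theorem hasMFDerivAt_toOne {x y : G} (h : y = x) :
    HasMFDerivAt (𝓡 4) (𝓡 4) (fun z : G => x⁻¹ * z) y (toOne x) := by
  subst h
  exact (mdifferentiableAt_mul_left y⁻¹ y).hasMFDerivAt

theorem hasMFDerivAt_fromOne {x y : G} (h : y = 1) :
    HasMFDerivAt (𝓡 4) (𝓡 4) (fun z : G => x * z) y (fromOne x) := by
  subst h
  exact (mdifferentiableAt_mul_left x 1).hasMFDerivAt

theorem toOne_fromOne (x : G) (v : EuclideanSpace ℝ (Fin 4)) : toOne x (fromOne x v) = v := by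
  have h := ((hasMFDerivAt_toOne (mul_one x)).comp (1 : G)
    (hasMFDerivAt_fromOne (x := x) rfl)).mfderiv
  rw [show (fun y : G => x⁻¹ * y) ∘ (fun y : G => x * y) = id by ext y; simp, mfderiv_id] at h
  exact (DFunLike.congr_fun h v).symm

theorem fromOne_toOne (x : G) (v : EuclideanSpace ℝ (Fin 4)) : fromOne x (toOne x v) = v := by
  have h := ((hasMFDerivAt_fromOne (x := x) (inv_mul_cancel x)).comp x
    (hasMFDerivAt_toOne rfl)).mfderiv
  rw [show (fun y : G => x * y) ∘ (fun y : G => x⁻¹ * y) = id by ext y; simp, mfderiv_id] at h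
  exact (DFunLike.congr_fun h v).symm

theorem toOne_mul (a x : G) (v : EuclideanSpace ℝ (Fin 4)) :
    toOne (a * x) (mfderiv (𝓡 4) (𝓡 4) (fun y : G => a * y) x v) = toOne x v := by
  have h1 : (fun y : G => (a * x)⁻¹ * y) ∘ (fun y : G => a * y) = fun y => x⁻¹ * y := by
    ext y; simp [mul_assoc]
  have h2 := mfderiv_comp (I := 𝓡 4) (I' := 𝓡 4) (I'' := 𝓡 4) (x := x)
    (g := fun y : G => (a * x)⁻¹ * y) (f := fun y : G => a * y)
    (mdifferentiableAt_mul_left (a * x)⁻¹ (a * x)) (mdifferentiableAt_mul_left a x)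
  rw [h1] at h2
  exact (DFunLike.congr_fun h2 v).symm

theorem toOne_mulInvariantVectorField (v : GroupLieAlgebra (𝓡 4) G) (x : G) :
    toOne x (mulInvariantVectorField v x) = v := toOne_fromOne x v

theorem contMDiffAt_toOne (x₀ : G) :
    ContMDiffAt (𝓡 4) 𝓘(ℝ, EuclideanSpace ℝ (Fin 4) →L[ℝ] EuclideanSpace ℝ (Fin 4)) ∞
      (fun x => (toOne x).comp ((trivializationAt (EuclideanSpace ℝ (Fin 4))
        (TangentSpace (𝓡 4) : G → Type _) x₀).symmL ℝ x)) x₀ := by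
  have h := ContMDiffAt.mfderiv (I := 𝓡 4) (I' := 𝓡 4) (J := 𝓡 4) (m := ∞) (n := ∞) (x₀ := x₀)
    (fun x y : G => x⁻¹ * y) id
    ((contMDiff_fst.inv.mul contMDiff_snd).contMDiffAt) contMDiffAt_id (by simp)
  -- The target trivialization is the identity over the point at which it is centred. Its points
  -- appear as `x₀⁻¹ * x₀` and `x⁻¹ * x`, hence the variables `p` and `q`.
  have hid : ∀ p q : G, p = 1 → q = 1 → ∀ v : EuclideanSpace ℝ (Fin 4),
      (trivializationAt (EuclideanSpace ℝ (Fin 4))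
        (TangentSpace (𝓡 4) : G → Type _) p).continuousLinearMapAt ℝ q v = v := by
    rintro p q rfl rfl v
    rw [TangentBundle.continuousLinearMapAt_trivializationAt_eq_core (mem_chart_source _ _)]
    exact (tangentBundleCore (𝓡 4) G).coordChange_self _ _ (mem_chart_source _ _) v
  refine h.congr_of_eventuallyEq (Eventually.of_forall fun x => ?_)
  ext1 v
  exact (hid (x₀⁻¹ * x₀) (x⁻¹ * x) (inv_mul_cancel _) (inv_mul_cancel _) _).symm

theorem contMDiff_leftForm (b : Module.Basis (Fin 4) ℝ (GroupLieAlgebra (𝓡 4) G)) :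
    ContMDiff (𝓡 4) ((𝓡 4).prod
      𝓘(ℝ, EuclideanSpace ℝ (Fin 4) →L[ℝ] EuclideanSpace ℝ (Fin 4) →L[ℝ] ℝ)) ∞
      (fun x : G => Bundle.TotalSpace.mk'
        (EuclideanSpace ℝ (Fin 4) →L[ℝ] EuclideanSpace ℝ (Fin 4) →L[ℝ] ℝ)
        (E := fun x : G => TangentSpace (𝓡 4) x →L[ℝ] TangentSpace (𝓡 4) x →L[ℝ] ℝ)
        x (leftForm b x)) := by
  intro x₀
  rw [Bundle.contMDiffAt_section]
  let A : G → EuclideanSpace ℝ (Fin 4) →L[ℝ] EuclideanSpace ℝ (Fin 4) := fun x =>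
    (coordEquiv b).toContinuousLinearMap.comp ((toOne x).comp
      ((trivializationAt (EuclideanSpace ℝ (Fin 4))
        (TangentSpace (𝓡 4) : G → Type _) x₀).symmL ℝ x))
  have hA : ContMDiffAt (𝓡 4) 𝓘(ℝ, EuclideanSpace ℝ (Fin 4) →L[ℝ] EuclideanSpace ℝ (Fin 4)) ∞
      A x₀ := contMDiffAt_const.clm_comp (contMDiffAt_toOne x₀)
  -- In the trivialization at `x₀` the form is `(v, w) ↦ ⟪A x v, A x w⟫`, and `A` is smooth at `x₀`.
  have h1 : ContMDiffAt (𝓡 4)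
      𝓘(ℝ, EuclideanSpace ℝ (Fin 4) →L[ℝ] EuclideanSpace ℝ (Fin 4) →L[ℝ] ℝ) ∞
      (fun x => ((ContinuousLinearMap.compL ℝ (EuclideanSpace ℝ (Fin 4))
        (EuclideanSpace ℝ (Fin 4)) ℝ).flip (A x)).comp (innerForm.comp (A x))) x₀ :=
    (contMDiffAt_const.clm_apply hA).clm_comp (contMDiffAt_const.clm_comp hA)
  refine h1.congr_of_eventuallyEq ?_
  filter_upwards [(chartAt (EuclideanSpace ℝ (Fin 4)) x₀).open_source.mem_nhds
    (mem_chart_source _ x₀)] with x hx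
  ext1 v
  ext1 w
  have hb : x ∈ (trivializationAt (EuclideanSpace ℝ (Fin 4))
      (TangentSpace (𝓡 4) : G → Type _) x₀).baseSet := hx
  rw [hom_trivializationAt_apply]
  refine (inCoordinates_apply_eq₂ hb hb (by simp)).trans ?_
  refine (DFunLike.congr_fun (Bundle.Trivial.linearMapAt_trivialization ℝ G ℝ x) _).trans ?_
  have hsymm : ∀ u : EuclideanSpace ℝ (Fin 4), A x u = coordEquiv b (toOne x
      ((trivializationAt (EuclideanSpace ℝ (Fin 4))
        (TangentSpace (𝓡 4) : G → Type _) x₀).symm x u)) := fun u =>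
    congrArg (fun p => coordEquiv b (toOne x p)) (Bundle.Trivialization.symmL_apply _ hb u)
  change leftForm b x _ _ = innerForm (A x v) (A x w)
  rw [hsymm, hsymm]
  rfl

theorem toOne_injective (x : G) : Function.Injective (toOne x) := fun u v h => by
  rw [← fromOne_toOne x u, h, fromOne_toOne]

/-- The left-invariant metric for which a basis of the Lie algebra is orthonormal. -/
def leftMetric (b : Module.Basis (Fin 4) ℝ (GroupLieAlgebra (𝓡 4) G)) :
    Bundle.ContMDiffRiemannianMetric (𝓡 4) ∞ (EuclideanSpace ℝ (Fin 4))
      (fun x : G => TangentSpace (𝓡 4) x) where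
  inner := leftForm b
  symm x v w := by rw [leftForm_apply, leftForm_apply, real_inner_comm]
  pos x v hv := by
    rw [leftForm_apply]
    refine real_inner_self_pos.2 fun h => hv ?_
    exact toOne_injective x (((coordEquiv b).map_eq_zero_iff.1 h).trans (map_zero (toOne x)).symm)
  isVonNBounded x := by
    have hball : Bornology.IsVonNBounded ℝ (Metric.ball (0 : EuclideanSpace ℝ (Fin 4)) 1) :=
      NormedSpace.isVonNBounded_ball ℝ _ 1
    have himage := hball.image ((fromOne x).comp (coordEquiv b).symm.toContinuousLinearMap)
    -- The unit ball of the form at `x` lies in the image of the Euclidean unit ball under a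
    -- continuous linear map.
    have hsub : {v : EuclideanSpace ℝ (Fin 4) | leftInner b x v v < 1} ⊆
        (fromOne x).comp (coordEquiv b).symm.toContinuousLinearMap '' Metric.ball 0 1 := ?_
    · exact himage.subset hsub
    refine fun v hv => ⟨coordEquiv b (toOne x v), ?_, ?_⟩
    · have hv' : inner ℝ (coordEquiv b (toOne x v)) (coordEquiv b (toOne x v)) < 1 := hv
      rw [real_inner_self_eq_norm_sq, sq_lt_one_iff₀ (norm_nonneg _)] at hv'
      simpa using hv'
    · exact (congrArg (fromOne x) ((coordEquiv b).symm_apply_apply _)).trans (fromOne_toOne x v)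
  contMDiff := contMDiff_leftForm b

theorem isLeftInvariant_leftMetric (b : Module.Basis (Fin 4) ℝ (GroupLieAlgebra (𝓡 4) G)) :
    IsLeftInvariant (leftMetric b).inner := by
  intro a x u v
  exact (leftForm_apply b (a * x) _ _).trans
    ((congrArg₂ (fun p q => inner ℝ (coordEquiv b p) (coordEquiv b q)) (toOne_mul a x u)
      (toOne_mul a x v)).trans (leftForm_apply b x u v).symm)

theorem leftMetric_leftFrame (b : Module.Basis (Fin 4) ℝ (GroupLieAlgebra (𝓡 4) G)) (x : G)
    (i j : Fin 4) :
    (leftMetric b).inner x (leftFrame b i x) (leftFrame b j x) = if i = j then 1 else 0 := by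
  have h : ∀ k, coordEquiv b (toOne x (leftFrame b k x)) = EuclideanSpace.single k 1 := fun k =>
    (congrArg (coordEquiv b) (toOne_mulInvariantVectorField (b k) x)).trans (coordEquiv_apply b k)
  refine (leftForm_apply b x _ _).trans ?_
  rw [h, h]
  refine (EuclideanSpace.inner_single_left (𝕜 := ℝ) i 1 _).trans ?_
  simp

omit [LieGroup (𝓡 4) ∞ G] in
theorem mulInvariantVectorField_one (v : GroupLieAlgebra (𝓡 4) G) :
    mulInvariantVectorField v (1 : G) = v := by
  have h : (fun y : G => 1 * y) = id := by ext y; simp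
  simp only [mulInvariantVectorField]
  rw [h, mfderiv_id]
  rfl

theorem leftMetric_basis (b : Module.Basis (Fin 4) ℝ (GroupLieAlgebra (𝓡 4) G)) (i j : Fin 4) :
    (leftMetric b).inner 1 (b i) (b j) = if i = j then 1 else 0 := by
  have h := leftMetric_leftFrame b 1 i j
  simp only [leftFrame, mulInvariantVectorField_one] at h
  exact h

omit [LieGroup (𝓡 4) ∞ G] in
theorem mulInvariantVectorField_sum {ι : Type*} (s : Finset ι) (c : ι → ℝ)
    (v : ι → GroupLieAlgebra (𝓡 4) G) (x : G) :
    mulInvariantVectorField (∑ i ∈ s, c i • v i) x =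
      ∑ i ∈ s, c i • mulInvariantVectorField (v i) x := by
  simp only [mulInvariantVectorField, map_sum, map_smul]
  rfl

theorem isConstantFrame_leftFrame (b : Module.Basis (Fin 4) ℝ (GroupLieAlgebra (𝓡 4) G))
    {C : Fin 4 → Fin 4 → Fin 4 → ℝ} (hb : ∀ i j, ⁅b i, b j⁆ = ∑ k, C i j k • b k) :
    IsConstantFrame (leftMetric b).inner (leftFrame b) C where
  smooth i := by
    have h := contMDiff_mulInvariantVectorField (I := 𝓡 4) (b i)
    rwa [show minSmoothness ℝ 2 = 2 from minSmoothness_of_isRCLikeNormedField] at h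
  brk_eq i j := by
    funext x
    have h := congrFun (mulInvariantVector_mlieBracket (b i) (b j)) x
    rw [← GroupLieAlgebra.bracket_def, hb, mulInvariantVectorField_sum] at h
    exact h.symm
  orthonormal x i j := leftMetric_leftFrame b x i j

theorem lie_groupBasis (φ : (ℝ ⊗[QSqrt] Alg) ≃ₗ⁅ℝ⁆ GroupLieAlgebra (𝓡 4) G) (i j : Fin 4) :
    ⁅groupBasis φ i, groupBasis φ j⁆ =
      ∑ k, structConst √2 (1 / √3) i j k • groupBasis φ k := by
  have h : ∀ k, groupBasis φ k = φ (realBasis k) := fun k => rfl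
  simp only [h]
  rw [← LieEquiv.map_lie, lie_realBasis, map_sum]
  simp only [map_smul]

theorem isNontriviallyBachFlat_leftMetric
    (φ : (ℝ ⊗[QSqrt] Alg) ≃ₗ⁅ℝ⁆ GroupLieAlgebra (𝓡 4) G) :
    IsNontriviallyBachFlat (leftMetric (groupBasis φ)).inner (leftFrame (groupBasis φ)) := by
  have : IsManifold (𝓡 4) ∞ G := LieGroup.toContMDiffMul.toIsManifold
  have hE := isConstantFrame_leftFrame (groupBasis φ) (lie_groupBasis φ)
  have hs : √2 ^ 2 = 2 := Real.sq_sqrt (by norm_num)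
  have ht : (1 / √3) ^ 2 = 1 / 3 := by rw [div_pow, Real.sq_sqrt (by norm_num)]; norm_num
  exact ⟨hE.isBachFlat hs ht, fun U hU hne =>
    ⟨hE.not_isConformallyEinsteinOn (by positivity) hU hne,
      hE.not_isHalfConformallyFlatOn hs hne⟩⟩

end LeftInvariantMetric
end BachFlat

namespace BachFlat

/-! ### A simply connected Lie group -/

/-- The weights of the action of `ℝ²` on `ℝ²`. -/
def weight (ε : ℝ) (x : EuclideanSpace ℝ (Fin 4)) : ℝ := -√2 * x 0 + ε * (√2 * (1 / √3)) * x 1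

/-- The product of `ℝ² ⋉ ℝ²`. -/
def semiMul (x y : EuclideanSpace ℝ (Fin 4)) : EuclideanSpace ℝ (Fin 4) :=
  !₂[x 0 + y 0, x 1 + y 1, x 2 + Real.exp (weight 1 x) * y 2,
    x 3 + Real.exp (weight (-1) x) * y 3]

/-- The inverse in `ℝ² ⋉ ℝ²`. -/
def semiInv (x : EuclideanSpace ℝ (Fin 4)) : EuclideanSpace ℝ (Fin 4) :=
  !₂[-x 0, -x 1, -Real.exp (-weight 1 x) * x 2, -Real.exp (-weight (-1) x) * x 3]

/-- Weights see only the two coordinates that add, so they are homomorphisms to `ℝ`; associativity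
rests on this. The coefficients are eigenvalues on the derived algebra: `e₁` acts as `-s`, and `e₂`
has eigenvalues `±√(1 - t²) = ±st`. -/
theorem weight_semiMul (ε : ℝ) (x y : EuclideanSpace ℝ (Fin 4)) :
    weight ε (semiMul x y) = weight ε x + weight ε y := by
  simp [weight, semiMul]; ring

theorem weight_semiInv (ε : ℝ) (x : EuclideanSpace ℝ (Fin 4)) :
    weight ε (semiInv x) = -weight ε x := by
  simp [weight, semiInv]; ring

theorem weight_zero (ε : ℝ) : weight ε 0 = 0 := by simp [weight]

/-- The group `ℝ² ⋉ ℝ²`. -/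
abbrev semiGroup : Group (EuclideanSpace ℝ (Fin 4)) :=
  letI : Mul (EuclideanSpace ℝ (Fin 4)) := ⟨semiMul⟩
  letI : One (EuclideanSpace ℝ (Fin 4)) := ⟨0⟩
  letI : Inv (EuclideanSpace ℝ (Fin 4)) := ⟨semiInv⟩
  Group.ofLeftAxioms
    (fun x y z => by
      change semiMul (semiMul x y) z = semiMul x (semiMul y z)
      ext i
      rw [semiMul, weight_semiMul, weight_semiMul, Real.exp_add, Real.exp_add]
      fin_cases i <;> simp [semiMul] <;> ring)
    (fun x => by
      change semiMul 0 x = x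
      ext i
      fin_cases i <;> simp [semiMul, weight_zero])
    (fun x => by
      change semiMul (semiInv x) x = 0
      ext i
      rw [semiMul, weight_semiInv, weight_semiInv]
      fin_cases i <;> simp [semiInv])

theorem contDiff_semiMul :
    ContDiff ℝ ∞ fun p : EuclideanSpace ℝ (Fin 4) × EuclideanSpace ℝ (Fin 4) =>
      semiMul p.1 p.2 := by
  rw [contDiff_euclidean]
  intro i
  fin_cases i <;> simp [semiMul, weight] <;> fun_prop

theorem contDiff_semiInv : ContDiff ℝ ∞ semiInv := by
  rw [contDiff_euclidean]
  intro i
  fin_cases i <;> simp [semiInv, weight] <;> fun_prop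

/-- The group `ℝ² ⋉ ℝ²` is a Lie group. -/
theorem semiLieGroup : letI := semiGroup; LieGroup (𝓡 4) ∞ (EuclideanSpace ℝ (Fin 4)) :=
  letI := semiGroup
  { contMDiff_mul := by
      have h := contDiff_semiMul.contMDiff
      rw [modelWithCornersSelf_prod, ← chartedSpaceSelf_prod] at h
      exact h
    contMDiff_inv := contDiff_semiInv.contMDiff }

/-! ### The Lie algebra of the group `ℝ² ⋉ ℝ²` -/

/-- The differential at the identity of the left translation by `x`. -/
def semiLin (x : EuclideanSpace ℝ (Fin 4)) :
    EuclideanSpace ℝ (Fin 4) →L[ℝ] EuclideanSpace ℝ (Fin 4) :=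
  LinearMap.toContinuousLinearMap
    { toFun := fun v => !₂[v 0, v 1, Real.exp (weight 1 x) * v 2, Real.exp (weight (-1) x) * v 3]
      map_add' := fun u v => by ext i; fin_cases i <;> simp [mul_add]
      map_smul' := fun c v => by ext i; fin_cases i <;> simp <;> ring }

theorem semiLin_apply (x v : EuclideanSpace ℝ (Fin 4)) : semiLin x v =
    !₂[v 0, v 1, Real.exp (weight 1 x) * v 2, Real.exp (weight (-1) x) * v 3] := rfl

theorem semiLin_zero (v : EuclideanSpace ℝ (Fin 4)) : semiLin 0 v = v := by
  rw [semiLin_apply, weight_zero, weight_zero]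
  ext i
  fin_cases i <;> simp

theorem hasFDerivAt_semiMul (x y : EuclideanSpace ℝ (Fin 4)) :
    HasFDerivAt (semiMul x) (semiLin x) y := by
  -- Left translations are affine, so their differential is the same at every point.
  have h : semiMul x = fun y => x + semiLin x y := by
    funext y
    ext i
    fin_cases i <;> simp [semiMul, semiLin_apply]
  rw [h]
  exact (semiLin x).hasFDerivAt.const_add x

/-- The linear form `weight ε`. -/
def weightL (ε : ℝ) : EuclideanSpace ℝ (Fin 4) →L[ℝ] ℝ :=
  (-√2) • EuclideanSpace.proj (𝕜 := ℝ) (0 : Fin 4)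
    + (ε * (√2 * (1 / √3))) • EuclideanSpace.proj (𝕜 := ℝ) (1 : Fin 4)

theorem weightL_apply (ε : ℝ) (x : EuclideanSpace ℝ (Fin 4)) : weightL ε x = weight ε x := by
  simp [weightL, weight]

/-- The derivative at the identity of the left-invariant vector field with value `v` there. -/
def semiDer (v : EuclideanSpace ℝ (Fin 4)) :
    EuclideanSpace ℝ (Fin 4) →L[ℝ] EuclideanSpace ℝ (Fin 4) :=
  LinearMap.toContinuousLinearMap
    { toFun := fun u => !₂[0, 0, weightL 1 u * v 2, weightL (-1) u * v 3]
      map_add' := fun u v => by ext i; fin_cases i <;> simp [add_mul]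
      map_smul' := fun c v => by ext i; fin_cases i <;> simp [mul_assoc] }

theorem semiDer_apply (v u : EuclideanSpace ℝ (Fin 4)) : semiDer v u =
    !₂[0, 0, weightL 1 u * v 2, weightL (-1) u * v 3] := rfl

theorem hasFDerivAt_exp_weight (ε c : ℝ) :
    HasFDerivAt (fun x => Real.exp (weight ε x) * c) (c • weightL ε) 0 := by
  have h : HasFDerivAt (weight ε) (weightL ε) 0 := by
    have := (weightL ε).hasFDerivAt (x := 0)
    exact this.congr_of_eventuallyEq (Filter.Eventually.of_forall fun x => (weightL_apply ε x).symm)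
  have h2 := (h.exp).mul_const c
  rw [weight_zero, Real.exp_zero, one_smul] at h2
  exact h2

theorem hasFDerivAt_semiLin (v : EuclideanSpace ℝ (Fin 4)) :
    HasFDerivAt (fun x => semiLin x v) (semiDer v) 0 := by
  rw [← hasFDerivWithinAt_univ, hasFDerivWithinAt_euclidean]
  simp only [hasFDerivWithinAt_univ]
  intro i
  fin_cases i
  · refine (hasFDerivAt_const (v 0) _).congr_fderiv ?_
    ext u; simp [semiDer_apply]
  · refine (hasFDerivAt_const (v 1) _).congr_fderiv ?_
    ext u; simp [semiDer_apply]
  · refine (hasFDerivAt_exp_weight 1 (v 2)).congr_fderiv ?_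
    ext u; simp [semiDer_apply, mul_comm]
  · refine (hasFDerivAt_exp_weight (-1) (v 3)).congr_fderiv ?_
    ext u; simp [semiDer_apply, mul_comm]

theorem mulInvariantVectorField_semiGroup (v : EuclideanSpace ℝ (Fin 4)) :
    letI := semiGroup
    (mulInvariantVectorField (I := 𝓡 4) (G := EuclideanSpace ℝ (Fin 4)) v :
      (x : EuclideanSpace ℝ (Fin 4)) → TangentSpace (𝓡 4) x) = fun x => semiLin x v := by
  let := semiGroup
  funext x
  have h : mfderiv (𝓡 4) (𝓡 4) (fun y : EuclideanSpace ℝ (Fin 4) => x * y) 1 = semiLin x :=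
    (hasFDerivAt_semiMul x 0).hasMFDerivAt.mfderiv
  exact DFunLike.congr_fun h v

theorem lie_semiGroup (v w : EuclideanSpace ℝ (Fin 4)) :
    letI := semiGroup
    letI := semiLieGroup
    (⁅(show GroupLieAlgebra (𝓡 4) (EuclideanSpace ℝ (Fin 4)) from v),
      (show GroupLieAlgebra (𝓡 4) (EuclideanSpace ℝ (Fin 4)) from w)⁆ :
        GroupLieAlgebra (𝓡 4) (EuclideanSpace ℝ (Fin 4))) = semiDer w v - semiDer v w := by
  let := semiGroup
  let := semiLieGroup
  refine (GroupLieAlgebra.bracket_def _ _).trans ?_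
  rw [mulInvariantVectorField_semiGroup, mulInvariantVectorField_semiGroup]
  have h := VectorField.mlieBracketWithin_eq_lieBracketWithin (𝕜 := ℝ)
    (V := fun x : EuclideanSpace ℝ (Fin 4) => semiLin x v) (W := fun x => semiLin x w)
    (s := Set.univ)
  refine (congrFun VectorField.mlieBracketWithin_univ.symm _).trans ((congrFun h 0).trans ?_)
  rw [VectorField.lieBracketWithin_univ, VectorField.lieBracket, (hasFDerivAt_semiLin v).fderiv,
    (hasFDerivAt_semiLin w).fderiv,
    semiLin_zero, semiLin_zero]

/-- Vectors in the Lie algebra of `ℝ² ⋉ ℝ²` with the structure constants of `𝔤`. -/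
def semiVec : Fin 4 → EuclideanSpace ℝ (Fin 4) :=
  ![!₂[1, 0, 0, 0], !₂[0, 1, 0, 0], !₂[0, 0, 1 / √3, 1 / √3],
    !₂[0, 0, -1 - √2 * (1 / √3), √2 * (1 / √3) - 1]]

theorem linearIndependent_semiVec : LinearIndependent ℝ semiVec := by
  rw [Fintype.linearIndependent_iff]
  intro c hc
  have h : ∀ i, (∑ k, c k • semiVec k) i = 0 := fun i => by rw [hc]; rfl
  have h0 := h 0
  have h1 := h 1
  have h2 := h 2
  have h3 := h 3
  simp [Fin.sum_univ_four, semiVec] at h0 h1 h2 h3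
  -- The last two coordinates of the relation have the same coefficient of `c 2`, which their
  -- difference eliminates.
  have hc3 : c 3 = 0 := by
    have : (2 * (√2 * (√3)⁻¹)) * c 3 = 0 := by linear_combination h3 - h2
    have hne : 2 * (√2 * (√3)⁻¹) ≠ 0 := by positivity
    exact (mul_eq_zero.1 this).resolve_left hne
  have hc2 : c 2 = 0 := by simpa [hc3] using h2
  intro i
  fin_cases i
  exacts [h0, h1, hc2, hc3]

/-- The basis `semiVec`. -/
def semiBasis : Module.Basis (Fin 4) ℝ (EuclideanSpace ℝ (Fin 4)) :=
  basisOfLinearIndependentOfCardEqFinrank linearIndependent_semiVec (by simp)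

theorem semiBasis_apply (i : Fin 4) : semiBasis i = semiVec i := by
  simp [semiBasis]

/-- In eigencoordinates of `e₂`, `e₃` is taken to be `(t, t)`. The relation `[e₂, e₃] = -e₃ - t e₄`
then forces `e₄ = (-1 - st, st - 1)`. -/
theorem semiDer_semiVec (i j : Fin 4) :
    semiDer (semiVec j) (semiVec i) - semiDer (semiVec i) (semiVec j) =
      ∑ k, structConst √2 (1 / √3) i j k • semiVec k := by
  have hs : √2 ^ 2 = 2 := Real.sq_sqrt (by norm_num)
  have ht : (1 / √3) ^ 2 = 1 / 3 := by rw [div_pow, Real.sq_sqrt (by norm_num)]; norm_num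
  simp only [semiDer_apply, weightL_apply, weight, semiVec]
  generalize √2 = s at *
  generalize 1 / √3 = t at *
  ext l
  fin_cases i <;> fin_cases j <;> fin_cases l <;>
    simp [Fin.sum_univ_four, structConst, bracketR] <;>
    first
    | ring1
    -- The bracket of `e₂` and `e₄`, in either order, needs the eigenvalue relation `s²t² = 1 - t²`.
    | linear_combination (-t ^ 2) * hs - 3 * ht
    | linear_combination (t ^ 2) * hs + 3 * ht

theorem exists_lieGroup :
    ∃ (G : Type) (_ : TopologicalSpace G) (_ : ChartedSpace (EuclideanSpace ℝ (Fin 4)) G)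
      (_ : Group G) (_ : LieGroup (𝓡 4) ∞ G),
      SimplyConnectedSpace G ∧ T2Space G ∧ SecondCountableTopology G ∧
      Nonempty ((ℝ ⊗[QSqrt] Alg) ≃ₗ⁅ℝ⁆ GroupLieAlgebra (𝓡 4) G) := by
  let := semiGroup
  let := semiLieGroup
  refine ⟨EuclideanSpace ℝ (Fin 4), inferInstance, inferInstance, semiGroup, semiLieGroup,
    inferInstance, inferInstance, inferInstance, ?_⟩
  refine nonempty_lieEquiv_of_basis realBasis
    (show Module.Basis (Fin 4) ℝ (GroupLieAlgebra (𝓡 4) (EuclideanSpace ℝ (Fin 4))) from semiBasis)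
    lie_realBasis fun i j => ?_
  refine (lie_semiGroup (semiBasis i) (semiBasis j)).trans ?_
  simp only [semiBasis_apply]
  refine (semiDer_semiVec i j).trans ?_
  simp only [← semiBasis_apply]
  rfl

end BachFlat

end

theorem theorem2 :
    -- the Lie algebra over `ℚ(√2, √3)` given by the displayed equations
    Module.finrank BachFlat.QSqrt BachFlat.Alg = 4 ∧
    LieAlgebra.IsSolvable BachFlat.Alg ∧
    Module.finrank BachFlat.QSqrt
      (LieAlgebra.derivedSeries BachFlat.QSqrt BachFlat.Alg 1) = 2 ∧
    LieAlgebra.derivedSeries BachFlat.QSqrt BachFlat.Alg 2 = ⊥ ∧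
    -- there is an associated Lie group, even a simply connected one
    (∃ (G : Type) (_ : TopologicalSpace G) (_ : ChartedSpace (EuclideanSpace ℝ (Fin 4)) G)
      (_ : Group G) (_ : LieGroup (𝓡 4) ∞ G),
      SimplyConnectedSpace G ∧ T2Space G ∧ SecondCountableTopology G ∧
      Nonempty ((ℝ ⊗[BachFlat.QSqrt] BachFlat.Alg) ≃ₗ⁅ℝ⁆ GroupLieAlgebra (𝓡 4) G)) ∧
    -- on every associated Lie group, the left-invariant metric for which the basis is orthonormal
    -- is non-trivially Bach-flat
    (∀ (G : Type*) [TopologicalSpace G] [ChartedSpace (EuclideanSpace ℝ (Fin 4)) G]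
      [Group G] [LieGroup (𝓡 4) ∞ G]
      (φ : (ℝ ⊗[BachFlat.QSqrt] BachFlat.Alg) ≃ₗ⁅ℝ⁆ GroupLieAlgebra (𝓡 4) G),
      ∃ g : Bundle.ContMDiffRiemannianMetric (𝓡 4) ∞ (EuclideanSpace ℝ (Fin 4))
          (fun x : G => TangentSpace (𝓡 4) x),
        BachFlat.IsLeftInvariant g.inner ∧
        (∀ i j, g.inner 1 (BachFlat.groupBasis φ i) (BachFlat.groupBasis φ j)
          = if i = j then 1 else 0) ∧
        BachFlat.IsNontriviallyBachFlat g.inner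
          (BachFlat.leftFrame (BachFlat.groupBasis φ))) := by
  refine ⟨BachFlat.finrank_alg, BachFlat.isSolvable_alg, BachFlat.finrank_derivedSeries_one,
    BachFlat.derivedSeries_two, BachFlat.exists_lieGroup, ?_⟩
  intro G _ _ _ _ φ
  exact ⟨BachFlat.leftMetric (BachFlat.groupBasis φ),
    BachFlat.isLeftInvariant_leftMetric _, BachFlat.leftMetric_basis _,
    BachFlat.isNontriviallyBachFlat_leftMetric φ⟩
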